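/- Setting. A $\Sigma$-protocol is a three-round public-coin protocol in which the prover sends $a$ (together with the instance $x$ if it is adaptive), the verifier $\mathcal V$ sends a uniformly random challenge $c$ from a finite non-empty set $\mathcal C$, the prover replies with $z$, and $\mathcal V$ accepts iff $V(x,a,c,z)=1$. Here $x,a,z$ are bit strings of fixed lengths $\ell,m,k$, and the elements of $\mathcal C=\{0,\dots,|\mathcal C|-1\}$ are written in binary with $n$ bits, $|\mathcal C|\le 2^n$. An adaptive Fiat–Shamir adversary $\mathcal A$ with $q\ge 1$ queries consists of a unit vector $|\phi_0\rangle$ and unitaries $A_1,\dots,A_q$ on registers $X$ (holding $(x,a)$), $Y$ ($n$ qubits), $Z$ (holding $z$) and an arbitrary internal register $E$. For $H:\{0,1\}^\ell\times\{0,1\}^m\to\mathcal C$ its output $(x,\pi)\leftarrow\mathcal A^H$, $\pi=(a,z)$, is obtained by measuring $X$ and $Z$ of $A_q\mathcal O^H\cdots A_1\mathcal O^H|\phi_0\rangle$ in the computational basis, where $\mathcal O^H|x,a\rangle|y\rangle=|x,a\rangle|y\oplus H(x,a)\rangle$; and $V^H_{FS}(x,\pi)$ means $V(x,a,H(x,a),z)=1$.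 A two-stage black-box quantum algorithm $\mathcal S$ is a fixed quantum program with classical control which is given $\ell,m,n,k,|\mathcal C|,q$ and one copy of $|\phi_0\rangle$, may apply the $A_j$ as black boxes, has access to $X,Y,Z$ and to polynomially many work qubits but not to $E$, outputs $(x,a)$ after its first stage, and $z$ after its second stage, at the beginning of which it receives $c$. It has no oracle $H$. It is polynomial-time if its total number of elementary steps is at most $p(\ell+m+n+k+q)$ for one polynomial $p$, where a call of some $A_j$ is one step. The pair $(x,v)\leftarrow\langle\mathcal S^{\mathcal A},\mathcal V\rangle$ is the instance $x$ sent by $\mathcal S^{\mathcal A}$ and the verdict $v$ of $\mathcal V$ on it. Theorem. There exist a polynomial-time two-stage black-box quantum algorithm $\mathcal S$ and an absolute constant $K>0$ such that for every $\Sigma$-protocol, every $q\ge 1$ and every adaptive Fiat–Shamir adversary $\mathcal A$ making $q$ queries to a uniformly random $H$ there are numbers $\varepsilon(x_\circ)\ge 0$ with $$\sum_{x_\circ}\varepsilon(x_\circ)\le\frac{1}{2q|\mathcal C|}$$ such that for every instance $x_\circ\in\{0,1\}^\ell$ $$\Pr\bigl[x=x_\circ\wedge v=\mathsf{accept}:(x,v)\leftarrow\langle\mathcal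 S^{\mathcal A},\mathcal V\rangle\bigr]\;\ge\;\frac{1}{Kq^2}\,\Pr_H\bigl[x=x_\circ\wedge V^H_{FS}(x,\pi):(x,\pi)\leftarrow\mathcal A^H\bigr]-\varepsilon(x_\circ).$$ -/

import Mathlib

universe u

namespace FiatShamir

noncomputable section

instance instFintypeBitVec (n : ℕ) : Fintype (BitVec n) :=
  Fintype.ofEquiv (Fin (2 ^ n)) BitVec.equivFin.symm.toEquiv

/-! ### Sigma-protocols, the random oracle, adaptive Fiat–Shamir adversaries -/

/-- The verifier's side of a Sigma-protocol. Instances, first messages and responses are bit strings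
of given lengths. The challenge space `C` is an arbitrary finite non-empty set, enumerated as
`Fin chalCard`; its elements are written in binary with `chalLen` bits. The verifier draws `c`
uniformly and accepts iff `V x a c z`. (The honest prover and the relation play no role for
dishonest provers, so they are not recorded.) -/
structure SigmaProtocol where
  instLen : ℕ
  comLen : ℕ
  chalLen : ℕ
  respLen : ℕ
  chalCard : ℕ
  chalCard_pos : 0 < chalCard
  chalCard_le : chalCard ≤ 2 ^ chalLen
  V : BitVec instLen → BitVec comLen → Fin chalCard → BitVec respLen → Bool

/-- The challenge space. -/
abbrev SigmaProtocol.Chal (P : SigmaProtocol) : Type := Fin P.chalCard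

/-- The binary encoding of a challenge. -/
def SigmaProtocol.encChal (P : SigmaProtocol) (c : P.Chal) : BitVec P.chalLen :=
  BitVec.ofNat P.chalLen c.val

/-- The functions `H : (x, a) ↦ c` from which the random oracle is drawn uniformly. -/
abbrev SigmaProtocol.Oracle (P : SigmaProtocol) : Type :=
  BitVec P.instLen × BitVec P.comLen → P.Chal

/-- Computational basis of the adversary's registers `X = (instance, first message)`, `Y`
(answers of the oracle) and `Z` (the response). -/
abbrev Basis (P : SigmaProtocol) : Type :=
  BitVec P.instLen × BitVec P.comLen × BitVec P.chalLen × BitVec P.respLen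

/-- The state space of the registers `X, Y, Z` together with an internal register whose state
space is the arbitrary complex inner product space `E`. -/
abbrev AdvSpace (P : SigmaProtocol) (E : Type*) [NormedAddCommGroup E] : Type _ :=
  PiLp 2 (fun _ : Basis P => E)

/-- An adaptive Fiat–Shamir adversary with `q` quantum queries: an initial state and unitaries
`A_1, …, A_q` (here indexed from `0`). -/
structure FSAdversary (P : SigmaProtocol) (q : ℕ) (E : Type*)
    [NormedAddCommGroup E] [InnerProductSpace ℂ E] where
  init : AdvSpace P E
  norm_init : ‖init‖ = 1
  U : Fin q → (AdvSpace P E ≃ₗᵢ[ℂ] AdvSpace P E)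

section adversary

variable {P : SigmaProtocol} {q : ℕ} {E : Type*} [NormedAddCommGroup E] [InnerProductSpace ℂ E]

/-- The query unitary `O^H : |x⟩|a⟩|y⟩|z⟩ ↦ |x⟩|a⟩|y ⊕ H(x,a)⟩|z⟩`. -/
def queryOp (H : P.Oracle) (ψ : AdvSpace P E) : AdvSpace P E :=
  WithLp.toLp 2 fun b => ψ (b.1, b.2.1, b.2.2.1 ^^^ P.encChal (H (b.1, b.2.1)), b.2.2.2)

/-- Apply the adversary's unitary of index `j` (nothing happens if there is none). -/
def FSAdversary.applyU (A : FSAdversary P q E) (j : ℕ) (ψ : AdvSpace P E) : AdvSpace P E :=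
  if h : j < q then A.U ⟨j, h⟩ ψ else ψ

/-- The state after the first `j` steps, each of them an oracle query followed by a unitary. -/
def FSAdversary.stateAfter (A : FSAdversary P q E) (H : P.Oracle) : ℕ → AdvSpace P E
  | 0 => A.init
  | j + 1 => A.applyU j (queryOp H (A.stateAfter H j))

/-- `Pr_H [x = x₀ ∧ V(x, a, H(x,a), z) : (x, (a, z)) ← A^H]` for a uniformly random `H`; the output
is obtained by measuring `X` and `Z` of the final state in the computational basis. -/
def FSAdversary.forgeProb (A : FSAdversary P q E) (x₀ : BitVec P.instLen) : ℝ :=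
  (∑ H : P.Oracle, ∑ b : Basis P,
      if b.1 = x₀ ∧ P.V b.1 b.2.1 (H (b.1, b.2.1)) b.2.2.2 = true then
        ‖A.stateAfter H q b‖ ^ 2 else 0) / (Fintype.card P.Oracle : ℝ)

end adversary

/-! ### Classical computations with logarithmic cost -/

/-- Classical memory: variables `0, 1, 2, …` holding natural numbers. -/
abbrev Store : Type := ℕ → ℕ

/-- Arithmetic expressions (truncated subtraction, division with remainder). -/
inductive Expr
  | lit (n : ℕ)
  | var (v : ℕ)
  | add (e₁ e₂ : Expr)
  | sub (e₁ e₂ : Expr)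
  | mul (e₁ e₂ : Expr)
  | div (e₁ e₂ : Expr)
  | mod (e₁ e₂ : Expr)

def Expr.eval (σ : Store) : Expr → ℕ
  | lit n => n
  | var v => σ v
  | add e₁ e₂ => e₁.eval σ + e₂.eval σ
  | sub e₁ e₂ => e₁.eval σ - e₂.eval σ
  | mul e₁ e₂ => e₁.eval σ * e₂.eval σ
  | div e₁ e₂ => e₁.eval σ / e₂.eval σ
  | mod e₁ e₂ => e₁.eval σ % e₂.eval σ

/-- The cost of one arithmetic operation on `a` and `b`: at least the product of the bit lengths. -/
def opCost (a b : ℕ) : ℕ := (Nat.size a + 1) * (Nat.size b + 1)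

/-- The cost of evaluating an expression, counted in bit operations. -/
def Expr.cost (σ : Store) : Expr → ℕ
  | lit n => Nat.size n + 1
  | var v => Nat.size (σ v) + 1
  | add e₁ e₂ => e₁.cost σ + e₂.cost σ + opCost (e₁.eval σ) (e₂.eval σ)
  | sub e₁ e₂ => e₁.cost σ + e₂.cost σ + opCost (e₁.eval σ) (e₂.eval σ)
  | mul e₁ e₂ => e₁.cost σ + e₂.cost σ + opCost (e₁.eval σ) (e₂.eval σ)
  | div e₁ e₂ => e₁.cost σ + e₂.cost σ + opCost (e₁.eval σ) (e₂.eval σ)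
  | mod e₁ e₂ => e₁.cost σ + e₂.cost σ + opCost (e₁.eval σ) (e₂.eval σ)

/-- Deterministic classical programs. `ite e c₁ c₂` tests whether `e` is non-zero, and `loop e c`
repeats `c` as many times as the value of `e` at the start of the loop. -/
inductive Code
  | skip
  | assign (v : ℕ) (e : Expr)
  | seq (c₁ c₂ : Code)
  | ite (e : Expr) (c₁ c₂ : Code)
  | loop (e : Expr) (c : Code)

/-- Run a classical program on a store; the second component accumulates the running time. -/
def Code.run : Code → Store × ℕ → Store × ℕ
  | skip, s => (s.1, s.2 + 1)
  | assign v e, s => (Function.update s.1 v (e.eval s.1), s.2 + e.cost s.1 + 1)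
  | seq c₁ c₂, s => c₂.run (c₁.run s)
  | ite e c₁ c₂, s =>
      if e.eval s.1 ≠ 0 then c₁.run (s.1, s.2 + e.cost s.1 + 1)
      else c₂.run (s.1, s.2 + e.cost s.1 + 1)
  | loop e c, s =>
      (fun t : Store × ℕ => c.run (t.1, t.2 + 1))^[e.eval s.1] (s.1, s.2 + e.cost s.1 + 1)

/-! ### Quantum programs with black-box access to an adversary -/

/-- The qubit registers a quantum program can address: the two parts of the adversary's register
`X`, its registers `Y` and `Z`, and a private work register. The adversary's internal register
is not addressable. -/
inductive Reg
  | inst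
  | com
  | chal
  | resp
  | work
  deriving DecidableEq

/-- Basis states of all qubits, with `w` work qubits. -/
abbrev Mem (P : SigmaProtocol) (w : ℕ) : Type := Basis P × BitVec w

section mem

variable {P : SigmaProtocol} {w : ℕ}

/-- The number of qubits of a register. -/
def regLen (P : SigmaProtocol) (w : ℕ) : Reg → ℕ
  | Reg.inst => P.instLen
  | Reg.com => P.comLen
  | Reg.chal => P.chalLen
  | Reg.resp => P.respLen
  | Reg.work => w

/-- The content of a register, as a number in binary. -/
def Mem.get (b : Mem P w) : Reg → ℕ
  | Reg.inst => b.1.1.toNat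
  | Reg.com => b.1.2.1.toNat
  | Reg.chal => b.1.2.2.1.toNat
  | Reg.resp => b.1.2.2.2.toNat
  | Reg.work => b.2.toNat

/-- Bitwise addition modulo 2 of the binary digits of `v` to a register (higher digits of `v` that do
not fit are dropped). -/
def Mem.xor (b : Mem P w) : Reg → ℕ → Mem P w
  | Reg.inst, v => ((b.1.1 ^^^ BitVec.ofNat _ v, b.1.2), b.2)
  | Reg.com, v => ((b.1.1, b.1.2.1 ^^^ BitVec.ofNat _ v, b.1.2.2), b.2)
  | Reg.chal, v => ((b.1.1, b.1.2.1, b.1.2.2.1 ^^^ BitVec.ofNat _ v, b.1.2.2.2), b.2)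
  | Reg.resp, v => ((b.1.1, b.1.2.1, b.1.2.2.1, b.1.2.2.2 ^^^ BitVec.ofNat _ v), b.2)
  | Reg.work, v => (b.1, b.2 ^^^ BitVec.ofNat _ v)

/-- The qubit `i` of register `r` in the basis state `b`. -/
def Mem.bit (b : Mem P w) (r : Reg) (i : ℕ) : Bool := (b.get r).testBit i

/-- The store `σ` with the contents of the five registers written to the variables `10, …, 14`,
except that `0` is written for the register `t`. -/
def Mem.load (b : Mem P w) (t : Reg) (σ : Store) : Store := fun v =>
  if v = 10 then (if t = Reg.inst then 0 else b.get Reg.inst)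
  else if v = 11 then (if t = Reg.com then 0 else b.get Reg.com)
  else if v = 12 then (if t = Reg.chal then 0 else b.get Reg.chal)
  else if v = 13 then (if t = Reg.resp then 0 else b.get Reg.resp)
  else if v = 14 then (if t = Reg.work then 0 else b.get Reg.work)
  else σ v

end mem

/-- Quantum programs with classical control and black-box access to the unitaries of an adversary.
* `classical`, `seq`, `ite`, `loop`: classical computation on the store, and control flow;
* `toss n v`: write `n` fair coin flips, read as a number in binary, to variable `v`;
* `had`, `tgate`, `cnot`: the gates H, T and CNOT on single qubits `(register, position)`;
* `apply t f`: the unitary that adds, modulo 2, to register `t` the value which the classical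
  program `f` computes from the other registers (and the store);
* `measure r lo n v`: measure the `n` qubits of register `r` from position `lo` on in the
  computational basis and write the outcome to variable `v`;
* `call j`: apply the adversary's unitary of index `j`. -/
inductive Prog
  | classical (c : Code)
  | seq (p₁ p₂ : Prog)
  | ite (e : Expr) (p₁ p₂ : Prog)
  | loop (e : Expr) (p : Prog)
  | toss (n : Expr) (v : ℕ)
  | had (r : Reg) (i : Expr)
  | tgate (r : Reg) (i : Expr)
  | cnot (r : Reg) (i : Expr) (r' : Reg) (i' : Expr)
  | apply (t : Reg) (f : Code)
  | measure (r : Reg) (lo n : Expr) (v : ℕ)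
  | call (j : Expr)

section machine

variable {P : SigmaProtocol} {q w : ℕ} {E : Type*} [NormedAddCommGroup E] [InnerProductSpace ℂ E]

/-- One branch of a run: the classical store, the unnormalised joint state of all qubits and of the
adversary's internal register, and the time spent so far. The probability of the branch is the
squared norm of the state. -/
structure Config (P : SigmaProtocol) (w : ℕ) (E : Type*) where
  store : Store
  state : Mem P w → E
  time : ℕ

/-- The probability of a branch. -/
def Config.weight (g : Config P w E) : ℝ := ∑ b : Mem P w, ‖g.state b‖ ^ 2

def Config.tick (g : Config P w E) (t : ℕ) : Config P w E := { g with time := g.time + t }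

/-- Hadamard gate on qubit `i` of register `r` (identity if there is no such qubit). -/
def hadOp (r : Reg) (i : ℕ) (ψ : Mem P w → E) : Mem P w → E := fun b =>
  if i < regLen P w r then
    ((1 / Real.sqrt 2 : ℝ) : ℂ) • ((if b.bit r i then -ψ b else ψ b) + ψ (b.xor r (2 ^ i)))
  else ψ b

/-- The gate `T = diag(1, exp(iπ/4))` on qubit `i` of register `r`. -/
def tOp (r : Reg) (i : ℕ) (ψ : Mem P w → E) : Mem P w → E := fun b =>
  if b.bit r i then Complex.exp (Complex.I * (Real.pi / 4 : ℝ)) • ψ b else ψ b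

/-- Controlled-NOT with control `(r, i)` and target `(r', i')` (identity if they coincide). -/
def cnotOp (r : Reg) (i : ℕ) (r' : Reg) (i' : ℕ) (ψ : Mem P w → E) : Mem P w → E := fun b =>
  if (r, i) ≠ (r', i') ∧ b.bit r i = true then ψ (b.xor r' (2 ^ i')) else ψ b

/-- The run of `f` in the basis state `b`, for target register `t`. -/
def codeOn (t : Reg) (f : Code) (σ : Store) (b : Mem P w) : Store × ℕ := f.run (b.load t σ, 0)

/-- The unitary `|b⟩ ↦ |b with f added to register t⟩`; the value of `f` is its variable `15`.
Since `f` does not see the register `t`, this is a self-inverse permutation of the basis. -/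
def applyOp (t : Reg) (f : Code) (σ : Store) (ψ : Mem P w → E) : Mem P w → E := fun b =>
  ψ (b.xor t ((codeOn t f σ b).1 15))

/-- The cost of `applyOp`: the number of qubits and the worst-case running time of `f`. -/
def applyCost (P : SigmaProtocol) (w : ℕ) (t : Reg) (f : Code) (σ : Store) : ℕ :=
  P.instLen + P.comLen + P.chalLen + P.respLen + w +
    Finset.univ.sup (fun b : Mem P w => (codeOn t f σ b).2)

/-- The projection onto outcome `m` when measuring `n` qubits of register `r` from `lo` on. -/
def measOp (r : Reg) (lo n m : ℕ) (ψ : Mem P w → E) : Mem P w → E := fun b =>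
  if b.get r / 2 ^ lo % 2 ^ n = m then ψ b else 0

/-- The adversary's unitary of index `j`, acting as the identity on the work register. -/
def callOp (A : FSAdversary P q E) (j : ℕ) (ψ : Mem P w → E) : Mem P w → E := fun b =>
  A.applyU j (WithLp.toLp 2 fun a => ψ (a, b.2)) b.1

/-- Run a quantum program: the list of all branches, one for every sequence of outcomes. -/
def Prog.exec (A : FSAdversary P q E) : Prog → Config P w E → List (Config P w E)
  | classical c, g =>
      let s := c.run (g.store, g.time)
      [⟨s.1, g.state, s.2⟩]
  | seq p₁ p₂, g => (p₁.exec A g).flatMap (p₂.exec A)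
  | ite e p₁ p₂, g =>
      if e.eval g.store ≠ 0 then p₁.exec A (g.tick (e.cost g.store + 1))
      else p₂.exec A (g.tick (e.cost g.store + 1))
  | loop e p, g =>
      (fun l : List (Config P w E) => l.flatMap fun h => p.exec A (h.tick 1))^[e.eval g.store]
        [g.tick (e.cost g.store + 1)]
  | toss n v, g =>
      let k := n.eval g.store
      (List.range (2 ^ k)).map fun m =>
        ⟨Function.update g.store v m, fun b => (((1 / Real.sqrt 2) ^ k : ℝ) : ℂ) • g.state b,
          g.time + n.cost g.store + k + 1⟩
  | had r i, g => [⟨g.store, hadOp r (i.eval g.store) g.state, g.time + i.cost g.store + 1⟩]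
  | tgate r i, g => [⟨g.store, tOp r (i.eval g.store) g.state, g.time + i.cost g.store + 1⟩]
  | cnot r i r' i', g =>
      [⟨g.store, cnotOp r (i.eval g.store) r' (i'.eval g.store) g.state,
        g.time + i.cost g.store + i'.cost g.store + 1⟩]
  | apply t f, g =>
      [⟨g.store, applyOp t f g.store g.state, g.time + applyCost P w t f g.store + 1⟩]
  | measure r lo n v, g =>
      let k := n.eval g.store
      (List.range (2 ^ k)).map fun m =>
        ⟨Function.update g.store v m, measOp r (lo.eval g.store) k m g.state,
          g.time + lo.cost g.store + n.cost g.store + k + 1⟩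
  | call j, g => [⟨g.store, callOp A (j.eval g.store) g.state, g.time + j.cost g.store + 1⟩]

end machine

/-! ### Two-stage black-box algorithms as adaptive Sigma-protocol adversaries -/

/-- The size parameter in which running times are measured. -/
def sizeParam (P : SigmaProtocol) (q : ℕ) : ℕ :=
  P.instLen + P.comLen + P.chalLen + P.respLen + q

/-- A two-stage black-box quantum algorithm: two fixed programs, and a polynomial that says how many
work qubits they get. -/
structure TwoStage where
  first : Prog
  second : Prog
  work : Polynomial ℕ

namespace TwoStage

variable {P : SigmaProtocol} {q : ℕ} {E : Type*} [NormedAddCommGroup E] [InnerProductSpace ℂ E]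

/-- The number of work qubits. -/
abbrev workLen (S : TwoStage) (P : SigmaProtocol) (q : ℕ) : ℕ := S.work.eval (sizeParam P q)

/-- The initial store: the register lengths, `|C|` and `q` in the variables `0, …, 5`. -/
def initStore (P : SigmaProtocol) (q : ℕ) : Store := fun v =>
  if v = 0 then P.instLen
  else if v = 1 then P.comLen
  else if v = 2 then P.chalLen
  else if v = 3 then P.respLen
  else if v = 4 then P.chalCard
  else if v = 5 then q
  else 0

/-- The start of `S^A`: one copy of the adversary's initial state, and work qubits in state `0`. -/
def start (S : TwoStage) (A : FSAdversary P q E) : Config P (S.workLen P q) E :=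
  ⟨initStore P q, fun b => if b.2 = 0#_ then A.init b.1 else 0, 0⟩

/-- The branches of the first stage. -/
def runFirst (S : TwoStage) (A : FSAdversary P q E) : List (Config P (S.workLen P q) E) :=
  S.first.exec A (S.start A)

/-- The branches of the second stage when the first one has ended in `g` and the challenge, given to
the program in variable `8`, is `c`. -/
def runSecond (S : TwoStage) (A : FSAdversary P q E) (g : Config P (S.workLen P q) E)
    (c : P.Chal) : List (Config P (S.workLen P q) E) :=
  S.second.exec A { g with store := Function.update g.store 8 c.val }

/-- The instance `x` sent after the first stage: variable `6`. -/
def outInst {w : ℕ} (g : Config P w E) : BitVec P.instLen := BitVec.ofNat _ (g.store 6)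

/-- The first message `a` sent after the first stage: variable `7`. -/
def outCom {w : ℕ} (g : Config P w E) : BitVec P.comLen := BitVec.ofNat _ (g.store 7)

/-- The response `z` sent after the second stage: variable `9`. -/
def outResp {w : ℕ} (g : Config P w E) : BitVec P.respLen := BitVec.ofNat _ (g.store 9)

/-- `Pr [x = x₀ ∧ v = accept : (x, v) ← ⟨S^A, V⟩]`: `S^A` sends `(x, a)`, receives a uniformly random
challenge `c`, sends `z`, and the verifier checks `V(x, a, c, z)`. -/
def acceptProb (S : TwoStage) (A : FSAdversary P q E) (x₀ : BitVec P.instLen) : ℝ :=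
  (∑ c : P.Chal,
    ((S.runFirst A).map fun g =>
      ((S.runSecond A g c).map fun g' =>
        if outInst g = x₀ ∧ P.V (outInst g) (outCom g) c (outResp g') = true then
          g'.weight else 0).sum).sum) / (P.chalCard : ℝ)

/-- Polynomial time: one polynomial in the bit lengths and `q` bounds the total running time of both
stages, on every branch, for all protocols, adversaries and challenges. -/
def IsPolyTime (S : TwoStage) : Prop :=
  ∃ p : Polynomial ℕ, ∀ (P : SigmaProtocol) (q : ℕ) (E : Type u) [NormedAddCommGroup E]
    [InnerProductSpace ℂ E] (A : FSAdversary P q E) (c : P.Chal),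
    ∀ g ∈ S.runFirst A, ∀ g' ∈ S.runSecond A g c, g'.time ≤ p.eval (sizeParam P q)

end TwoStage

end

end FiatShamir

/-!
Why the theorem holds. The reduction is the measure-and-reprogram algorithm, in the form that has a
purely multiplicative loss, so that the error terms `ε` can be taken to be zero. Let `φ i` be the state
of the adversary after `i` steps with oracle `H`, and let `H'` be `H` with its value at `x` replaced by
a challenge `c`. Changing the oracle from `H` to `H'` one query at a time only affects the components
of the `φ i` that query `x`, and so the final state with `H'` is the final state with `H` plus a
telescoping sum of `2 * q` vectors, each of which arises by projecting some `φ i` to query `x`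
and answering the remaining queries with `H'`, from this query on or from the next one on
(`FSAdversary.stateAfter_eq_add_sum`). By Cauchy–Schwarz, measuring a random query and reprogramming the
oracle afterwards loses a factor of `(2 * q + 1) ^ 2` only, and if `H` and `c` are uniformly random, then
so is `H'` (`sum_sum_update`, `FSAdversary.forgeProb_le`).

The reduction has no oracle and must simulate `H` in polynomial time. All probabilities in question lie
in the span of functions of at most `2 * q` values of `H` (`juntaSpan`), and hence a `2 * q`-wise
independent function will do. No finite field is needed: take a random polynomial of degree
less than `2 * q` with coefficients modulo a large power of two, and drop enough low binary digits
of its values. Since the product of differences of distinct nodes is a non-zero integer of bounded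
size, it divides a bounded power of two modulo `2 ^ N`, so interpolation works up to that power,
and the high digits are exactly independent and uniform (`exists_coeff_eval_eq`, `sum_polyHash_eq`).
Reducing the digits modulo `|C|` makes them slightly non-uniform, but with sufficiently many digits the
product distribution on all oracles still dominates half of the uniform one, pointwise
(`half_average_le_average_mod`). The random choice of the query is treated in the same way.

The rest describes the branches of the two programs and their running time (`Prog.Spec`). All
numbers have at most `bits P q` bits, a polynomial in the size parameter, and both stages take
`O(bits P q ^ 4)` steps.
-/

namespace FiatShamir

noncomputable section

/-! ### Bounded-independence hashing over `ZMod (2 ^ N)` -/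

/-- A non-zero integer of absolute value at most `2 ^ T` divides `2 ^ T` modulo `2 ^ N`. -/
theorem exists_mul_eq_two_pow (N T : ℕ) (D : ℤ) (hD : D ≠ 0) (hT : D.natAbs ≤ 2 ^ T) :
    ∃ w : ZMod (2 ^ N), w * (D : ZMod (2 ^ N)) = 2 ^ T := by
  have hg : Int.gcd D ((2 ^ N : ℕ) : ℤ) ∣ 2 ^ N := by
    have := Int.gcd_dvd_natAbs_right D ((2 ^ N : ℕ) : ℤ)
    simpa using this
  obtain ⟨v, -, hv⟩ := (Nat.dvd_prime_pow Nat.prime_two).1 hg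
  have hvT : v ≤ T := by
    have h1 : 2 ^ v ∣ D.natAbs := hv ▸ Int.gcd_dvd_natAbs_left D ((2 ^ N : ℕ) : ℤ)
    have h2 := (Nat.le_of_dvd (Int.natAbs_pos.2 hD) h1).trans hT
    exact (Nat.pow_le_pow_iff_right (by norm_num)).1 h2
  have hb := Int.gcd_eq_gcd_ab D ((2 ^ N : ℕ) : ℤ)
  rw [hv] at hb
  generalize D.gcdA ((2 ^ N : ℕ) : ℤ) = a at hb
  have hb' := congrArg (fun z : ℤ => (z : ZMod (2 ^ N))) hb
  simp only [Int.cast_add, Int.cast_mul, Int.cast_natCast, ZMod.natCast_self, zero_mul,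
    add_zero] at hb'
  refine ⟨(a : ZMod (2 ^ N)) * 2 ^ (T - v), ?_⟩
  have : (2 : ZMod (2 ^ N)) ^ T = 2 ^ v * 2 ^ (T - v) := by rw [← pow_add]; congr 1; omega
  rw [this]
  push_cast at hb'
  rw [hb']
  ring

/-- Interpolation up to the factor `2 ^ T`: over `ZMod (2 ^ N)` nodes `x ≠ y` need not differ by a
unit, but the numerators of the Lagrange polynomials take values at the nodes which are divisible
by no higher power of two than `2 ^ T`. -/
theorem exists_coeff_eval_eq (N L k : ℕ) (hk : 0 < k) (S : Finset ℕ) (hS : S.card ≤ k)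
    (hL : ∀ x ∈ S, x < 2 ^ L) (u : ℕ → ZMod (2 ^ N)) :
    ∃ t : Fin k → ZMod (2 ^ N), ∀ x ∈ S,
      ∑ j, t j * (x : ZMod (2 ^ N)) ^ (j : ℕ) = 2 ^ (L * k) * u x := by
  have hw : ∀ x ∈ S, ∃ w : ZMod (2 ^ N),
      w * ∏ y ∈ S.erase x, ((x : ZMod (2 ^ N)) - (y : ZMod (2 ^ N))) = 2 ^ (L * k) := by
    intro x hx
    have h0 : ∏ y ∈ S.erase x, ((x : ℤ) - (y : ℤ)) ≠ 0 := by
      rw [Finset.prod_ne_zero_iff]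
      intro y hy
      have := Finset.ne_of_mem_erase hy
      omega
    have h1 : (∏ y ∈ S.erase x, ((x : ℤ) - (y : ℤ))).natAbs ≤ 2 ^ (L * k) := by
      rw [← Int.natAbsHom_apply, map_prod]
      simp only [Int.natAbsHom_apply]
      calc ∏ y ∈ S.erase x, ((x : ℤ) - (y : ℤ)).natAbs
          ≤ ∏ y ∈ S.erase x, 2 ^ L := by
            refine Finset.prod_le_prod' fun y hy => ?_
            have h2 := hL x hx
            have h3 := hL y (Finset.mem_of_mem_erase hy)
            omega
        _ = 2 ^ (L * (S.erase x).card) := by rw [Finset.prod_const, pow_mul]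
        _ ≤ 2 ^ (L * k) := Nat.pow_le_pow_right (by norm_num)
            (Nat.mul_le_mul_left _ ((Finset.card_le_card (Finset.erase_subset _ _)).trans hS))
    obtain ⟨w, hw⟩ := exists_mul_eq_two_pow N (L * k) _ h0 h1
    refine ⟨w, ?_⟩
    rw [← hw]
    push_cast
    rfl
  choose! w hw using hw
  let Q : Polynomial (ZMod (2 ^ N)) := ∑ x ∈ S, Polynomial.C (u x * w x) *
    ∏ y ∈ S.erase x, (Polynomial.X - Polynomial.C (y : ZMod (2 ^ N)))
  have hQd : Q.natDegree < k := by
    refine lt_of_le_of_lt (Polynomial.natDegree_sum_le_of_forall_le (n := k - 1) S _ ?_)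
      (by omega)
    intro x hx
    refine (Polynomial.natDegree_C_mul_le _ _).trans ?_
    refine (Polynomial.natDegree_prod_le _ _).trans ?_
    calc ∑ y ∈ S.erase x, (Polynomial.X - Polynomial.C (y : ZMod (2 ^ N))).natDegree
        ≤ ∑ y ∈ S.erase x, 1 := by
          refine Finset.sum_le_sum fun y _ => ?_
          exact Polynomial.natDegree_X_sub_C_le _
      _ = S.card - 1 := by rw [Finset.sum_const, Finset.card_erase_of_mem hx]; simp
      _ ≤ k - 1 := by omega
  refine ⟨fun j => Q.coeff j, fun x hx => ?_⟩
  rw [Fin.sum_univ_eq_sum_range (fun j => Q.coeff j * (x : ZMod (2 ^ N)) ^ j) k,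
    ← Polynomial.eval_eq_sum_range' hQd]
  simp only [Q, Polynomial.eval_finsetSum, Polynomial.eval_mul, Polynomial.eval_C,
    Polynomial.eval_prod, Polynomial.eval_sub, Polynomial.eval_X]
  rw [Finset.sum_eq_single x]
  · rw [mul_assoc, hw x hx, mul_comm]
  · intro z hz hzx
    rw [Finset.prod_eq_zero (Finset.mem_erase.2 ⟨Ne.symm hzx, hx⟩) (sub_self _), mul_zero]
  · exact fun h => absurd hx h

/-- The `M` digits of `v : ZMod (2 ^ (T + M))` above the lowest `T`. -/
def highBits (T M : ℕ) (v : ZMod (2 ^ (T + M))) : ZMod (2 ^ M) := ((v.val / 2 ^ T : ℕ) : ZMod (2 ^ M))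

theorem highBits_natCast (T M n : ℕ) :
    highBits T M (n : ZMod (2 ^ (T + M))) = ((n / 2 ^ T : ℕ) : ZMod (2 ^ M)) := by
  rw [highBits, ZMod.val_natCast, pow_add, Nat.mod_mul_right_div_self, ZMod.natCast_mod]

theorem highBits_add (T M : ℕ) (v : ZMod (2 ^ (T + M))) (u : ℕ) :
    highBits T M (v + 2 ^ T * (u : ZMod (2 ^ (T + M)))) = highBits T M v + (u : ZMod (2 ^ M)) := by
  obtain ⟨n, rfl⟩ := ZMod.natCast_zmod_surjective v
  have : (n : ZMod (2 ^ (T + M))) + 2 ^ T * (u : ZMod (2 ^ (T + M)))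
      = ((n + 2 ^ T * u : ℕ) : ZMod (2 ^ (T + M))) := by push_cast; rfl
  rw [this, highBits_natCast, highBits_natCast, Nat.add_mul_div_left _ _ (by positivity)]
  push_cast
  rfl

/-- Averages of a function of at most `k` values agree for a uniformly random function and for
the high digits of a random polynomial of degree less than `k`: shifting the coefficients by an
interpolating polynomial shifts the values at the given points arbitrarily. -/
theorem sum_polyHash_eq {X V : Type*} [Fintype X] [DecidableEq X] [AddCommMonoid V]
    (enc : X → ℕ) (henc : Function.Injective enc)
    (L k M : ℕ) (hk : 0 < k) (hL : ∀ x, enc x < 2 ^ L)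
    (S : Finset X) (hS : S.card ≤ k) (F : (X → ZMod (2 ^ M)) → V) (hF : DependsOn F (S : Set X)) :
    Fintype.card (X → ZMod (2 ^ M)) • ∑ a : Fin k → ZMod (2 ^ (L * k + M)),
        F (fun x => highBits (L * k) M (∑ j, a j * (enc x : ZMod (2 ^ (L * k + M))) ^ (j : ℕ))) =
      Fintype.card (Fin k → ZMod (2 ^ (L * k + M))) • ∑ G, F G := by
  set g : (Fin k → ZMod (2 ^ (L * k + M))) → X → ZMod (2 ^ M) := fun a x =>
    highBits (L * k) M (∑ j, a j * (enc x : ZMod (2 ^ (L * k + M))) ^ (j : ℕ)) with hg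
  have hshift : ∀ G : X → ZMod (2 ^ M), ∑ a, F (g a) = ∑ a, F (g a + G) := by
    intro G
    obtain ⟨t, ht⟩ := exists_coeff_eval_eq (L * k + M) L k hk (S.image enc)
      (Finset.card_image_le.trans hS) (by simpa using fun x _ => hL x)
      (fun y => ((Function.extend enc G 0 y).val : ZMod (2 ^ (L * k + M))))
    rw [← Equiv.sum_comp (Equiv.addRight t) fun a => F (g a)]
    refine Finset.sum_congr rfl fun a _ => hF fun x hx => ?_
    have h1 := ht (enc x) (Finset.mem_image_of_mem _ hx)
    rw [henc.extend_apply] at h1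
    simp only [hg, Equiv.coe_addRight, Pi.add_apply, add_mul, Finset.sum_add_distrib, h1]
    rw [highBits_add, ZMod.natCast_zmod_val]
  calc Fintype.card (X → ZMod (2 ^ M)) • ∑ a, F (g a)
      = ∑ G : X → ZMod (2 ^ M), ∑ a, F (g a + G) := by
        rw [← Finset.card_univ, ← Finset.sum_const]
        exact Finset.sum_congr rfl fun G _ => hshift G
    _ = ∑ a, ∑ G : X → ZMod (2 ^ M), F (g a + G) := Finset.sum_comm
    _ = ∑ a : Fin k → ZMod (2 ^ (L * k + M)), ∑ G, F G :=
        Finset.sum_congr rfl fun a _ => Equiv.sum_comp (Equiv.addLeft (g a)) F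
    _ = _ := by rw [Finset.sum_const, Finset.card_univ]

/-! ### Reducing a uniform number modulo the size of the challenge space -/

theorem card_filter_mod_eq_ge (Y C : ℕ) (c : Fin C) :
    Y / C ≤ (Finset.univ.filter fun y : Fin Y => y.val % C = c.val).card := by
  have hlt : ∀ i : Fin (Y / C), c.val + C * i.val < Y := fun i => by
    have h1 : C * (i.val + 1) ≤ C * (Y / C) := Nat.mul_le_mul_left _ i.isLt
    have h2 := Nat.mul_div_le Y C
    have := c.isLt
    rw [mul_add] at h1
    omega
  have hC : 0 < C := c.pos
  calc Y / C = (Finset.univ : Finset (Fin (Y / C))).card := by simp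
    _ ≤ _ := Finset.card_le_card_of_injOn (fun i => ⟨c.val + C * i.val, hlt i⟩)
      (fun i _ => by simp [Nat.add_mul_mod_self_left, Nat.mod_eq_of_lt c.isLt])
      (fun i _ j _ h => by
        simp only [Fin.mk.injEq, Nat.add_left_cancel_iff] at h
        exact Fin.ext (Nat.eq_of_mul_eq_mul_left hC h))

/-- By Bernoulli's inequality, rounding `Y / C` down is harmless even to the power `n`. -/
theorem pow_half_le_of_card {C Y n : ℕ} (hC : 0 < C) (hY : 0 < Y) (h : 2 * (n * C) ≤ Y) :
    (1 / 2 : ℝ) * (1 / (C : ℝ)) ^ n ≤ (((Y / C : ℕ) : ℝ) / Y) ^ n := by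
  have hC' : (0 : ℝ) < C := by exact_mod_cast hC
  have hY' : (0 : ℝ) < Y := by exact_mod_cast hY
  rcases Nat.eq_zero_or_pos n with rfl | hn
  · norm_num
  have hn' : (1 : ℝ) ≤ n := by exact_mod_cast hn
  have h' : 2 * ((n : ℝ) * C) ≤ Y := by exact_mod_cast h
  have h1 : (Y : ℝ) - C ≤ ((Y / C : ℕ) : ℝ) * C := by
    have h2 : Y ≤ Y / C * C + C := by
      have := Nat.div_add_mod Y C
      have := Nat.mod_lt Y hC
      rw [mul_comm]; omega
    have : (Y : ℝ) ≤ ((Y / C : ℕ) : ℝ) * C + C := by exact_mod_cast h2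
    linarith
  have hx : (C : ℝ) / Y ≤ 1 := by
    rw [div_le_one hY']; nlinarith
  have hb : (1 / 2 : ℝ) ≤ (1 - C / Y) ^ n := by
    have := one_add_mul_le_pow (a := -((C : ℝ) / Y)) (by linarith) n
    have h3 : (n : ℝ) * (C / Y) ≤ 1 / 2 := by
      rw [← mul_div_assoc, div_le_iff₀ hY']; linarith
    calc (1 / 2 : ℝ) ≤ 1 + n * -((C : ℝ) / Y) := by linarith
      _ ≤ _ := by simpa [sub_eq_add_neg] using this
  calc (1 / 2 : ℝ) * (1 / (C : ℝ)) ^ n ≤ (1 - C / Y) ^ n * (1 / (C : ℝ)) ^ n := by gcongr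
    _ = ((1 - C / Y) * (1 / C)) ^ n := by rw [mul_pow]
    _ ≤ _ := by
      have h0 : 0 ≤ (1 - (C : ℝ) / Y) * (1 / C) := mul_nonneg (by linarith) (by positivity)
      refine pow_le_pow_left₀ h0 ?_ n
      have : (1 - (C : ℝ) / Y) * (1 / C) = (Y - C) / (C * Y) := by field_simp
      rw [this, div_le_div_iff₀ (by positivity) hY']
      nlinarith

/-- A uniformly random `G : X → Fin Y`, reduced modulo `C`, dominates half of the uniform
distribution on `X → Fin C` as soon as `Y` is at least twice `|X| * C`. -/
theorem half_average_le_average_mod {X : Type*} [Fintype X] [DecidableEq X] {C Y : ℕ}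
    (hC : 0 < C) (hY : 0 < Y) (h : 2 * (Fintype.card X * C) ≤ Y)
    (F : (X → Fin C) → ℝ) (hF : ∀ H, 0 ≤ F H) :
    (1 / 2 : ℝ) * ((∑ H, F H) / (Fintype.card (X → Fin C) : ℝ)) ≤
      (∑ G : X → Fin Y, F fun x => ⟨(G x).val % C, Nat.mod_lt _ hC⟩) /
        (Fintype.card (X → Fin Y) : ℝ) := by
  have hY' : (0 : ℝ) < Y := by exact_mod_cast hY
  have key : ((Y / C : ℕ) : ℝ) ^ Fintype.card X * ∑ H, F H ≤
      ∑ G : X → Fin Y, F fun x => ⟨(G x).val % C, Nat.mod_lt _ hC⟩ := by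
    rw [← Finset.sum_fiberwise_of_maps_to
      (g := fun (G : X → Fin Y) (x : X) => (⟨(G x).val % C, Nat.mod_lt _ hC⟩ : Fin C))
      (t := Finset.univ) (fun _ _ => Finset.mem_univ _), Finset.mul_sum]
    refine Finset.sum_le_sum fun H _ => ?_
    rw [Finset.sum_congr rfl (g := fun _ => F H)
      (fun G hG => by rw [(Finset.mem_filter.1 hG).2]), Finset.sum_const, nsmul_eq_mul]
    refine mul_le_mul_of_nonneg_right ?_ (hF H)
    have : (Finset.univ.filter fun G : X → Fin Y =>
        (fun x => (⟨(G x).val % C, Nat.mod_lt _ hC⟩ : Fin C)) = H) =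
        Fintype.piFinset fun x => Finset.univ.filter fun y : Fin Y => y.val % C = (H x).val := by
      ext G
      simp [funext_iff, Fin.ext_iff]
    rw [this, Fintype.card_piFinset]
    have h3 : (Y / C) ^ Fintype.card X ≤
        ∏ x, (Finset.univ.filter fun y : Fin Y => y.val % C = (H x).val).card := by
      rw [← Finset.card_univ, ← Finset.prod_const]
      exact Finset.prod_le_prod' fun x _ => card_filter_mod_eq_ge Y C (H x)
    exact_mod_cast h3
  have hs : 0 ≤ ∑ H, F H := Finset.sum_nonneg fun H _ => hF H
  calc (1 / 2 : ℝ) * ((∑ H, F H) / (Fintype.card (X → Fin C) : ℝ))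
      = ((1 / 2 : ℝ) * (1 / (C : ℝ)) ^ Fintype.card X) * ∑ H, F H := by
        simp only [Fintype.card_fun, Fintype.card_fin]; push_cast; rw [one_div_pow]; ring
    _ ≤ (((Y / C : ℕ) : ℝ) / Y) ^ Fintype.card X * ∑ H, F H :=
        mul_le_mul_of_nonneg_right (pow_half_le_of_card hC hY h) hs
    _ = (((Y / C : ℕ) : ℝ) ^ Fintype.card X * ∑ H, F H) / (Fintype.card (X → Fin Y) : ℝ) := by
        simp only [Fintype.card_fun, Fintype.card_fin]; push_cast; rw [div_pow]; ring
    _ ≤ _ := by gcongr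

/-! ### Functions of a random oracle that depend on few of its values -/

/-- The span of the functions of `H : X → C` that depend on at most `k` values of `H`. The state of
an algorithm after `k` queries to `H` lies in it. -/
def juntaSpan (X C : Type*) (V : Type*) [AddCommGroup V] [Module ℂ V] (k : ℕ) :
    Submodule ℂ ((X → C) → V) :=
  Submodule.span ℂ {f | ∃ S : Finset X, S.card ≤ k ∧ DependsOn f (S : Set X)}

section junta

variable {X C V W : Type*} [AddCommGroup V] [Module ℂ V] [AddCommGroup W] [Module ℂ W]

theorem juntaSpan_mono {k l : ℕ} (h : k ≤ l) : juntaSpan X C V k ≤ juntaSpan X C V l :=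
  Submodule.span_mono fun _ ⟨S, hS, hf⟩ => ⟨S, hS.trans h, hf⟩

theorem const_mem_juntaSpan (k : ℕ) (v : V) : (fun _ => v) ∈ juntaSpan X C V k :=
  Submodule.subset_span ⟨∅, by simp, fun _ _ _ => rfl⟩

theorem map_mem_juntaSpan {k : ℕ} {f : (X → C) → V} (hf : f ∈ juntaSpan X C V k) (L : V →ₗ[ℂ] W) :
    (fun H => L (f H)) ∈ juntaSpan X C W k := by
  induction hf using Submodule.span_induction with
  | mem f h =>
    obtain ⟨S, hS, hf⟩ := h
    exact Submodule.subset_span ⟨S, hS, fun _ _ hab => congrArg L (hf hab)⟩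
  | zero => simpa using const_mem_juntaSpan (X := X) (C := C) k (0 : W)
  | add f g _ _ hf hg => simpa using! Submodule.add_mem _ hf hg
  | smul a f _ hf => simpa using! Submodule.smul_mem _ a hf

/-- A linear map that is selected by one value of the oracle costs one more value. -/
theorem query_mem_juntaSpan [DecidableEq X] {k : ℕ} {f : (X → C) → V}
    (hf : f ∈ juntaSpan X C V k) (x : X) (L : C → V →ₗ[ℂ] W) :
    (fun H => L (H x) (f H)) ∈ juntaSpan X C W (k + 1) := by
  induction hf using Submodule.span_induction with
  | mem f h =>
    obtain ⟨S, hS, hf⟩ := h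
    refine Submodule.subset_span ⟨insert x S, (Finset.card_insert_le _ _).trans (by omega), ?_⟩
    intro a b hab
    have h1 : a x = b x := hab (i := x) (by simp)
    have h2 : f a = f b := hf fun y hy => hab (i := y) (by simp [Finset.mem_coe.1 hy])
    simp only [h1, h2]
  | zero => simpa using const_mem_juntaSpan (X := X) (C := C) (k + 1) (0 : W)
  | add f g _ _ hf hg => simpa using! Submodule.add_mem _ hf hg
  | smul a f _ hf => simpa using! Submodule.smul_mem _ a hf

theorem inner_mem_juntaSpan [DecidableEq X] {E : Type*} [NormedAddCommGroup E]
    [InnerProductSpace ℂ E] {k l : ℕ} {f g : (X → C) → E}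
    (hf : f ∈ juntaSpan X C E k) (hg : g ∈ juntaSpan X C E l) :
    (fun H => inner ℂ (f H) (g H)) ∈ juntaSpan X C ℂ (k + l) := by
  induction hf using Submodule.span_induction with
  | mem f h =>
    obtain ⟨S, hS, hf⟩ := h
    induction hg using Submodule.span_induction with
    | mem g h =>
      obtain ⟨S', hS', hg⟩ := h
      refine Submodule.subset_span ⟨S ∪ S', (Finset.card_union_le _ _).trans (by omega), ?_⟩
      intro a b hab
      have h1 : f a = f b := hf fun y hy => hab (i := y) (by simp [Finset.mem_coe.1 hy])
      have h2 : g a = g b := hg fun y hy => hab (i := y) (by simp [Finset.mem_coe.1 hy])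
      simp only [h1, h2]
    | zero => simpa using const_mem_juntaSpan (X := X) (C := C) (k + l) (0 : ℂ)
    | add g g' _ _ hg hg' => simpa [inner_add_right] using! Submodule.add_mem _ hg hg'
    | smul a g _ hg => simpa [inner_smul_right] using! Submodule.smul_mem _ a hg
  | zero => simpa using const_mem_juntaSpan (X := X) (C := C) (k + l) (0 : ℂ)
  | add f g _ _ hf hg => simpa [inner_add_left] using! Submodule.add_mem _ hf hg
  | smul a f _ hf =>
    convert Submodule.smul_mem _ ((starRingEnd ℂ) a) hf using 1
    funext H
    simp [mul_comm]

/-- Squared norms of amplitudes, that is, probabilities, depend on twice as many values. -/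
theorem norm_sq_mem_juntaSpan [DecidableEq X] {E : Type*} [NormedAddCommGroup E]
    [InnerProductSpace ℂ E] {k : ℕ} {f : (X → C) → E} (hf : f ∈ juntaSpan X C E k) :
    (fun H => ((‖f H‖ ^ 2 : ℝ) : ℂ)) ∈ juntaSpan X C ℂ (2 * k) := by
  rw [two_mul]
  convert inner_mem_juntaSpan hf hf using 2 with H
  rw [inner_self_eq_norm_sq_to_K]
  push_cast
  rfl

end junta

/-! ### The hash function -/

/-- The hash of the number `x` under the seed `s`: the base-`2 ^ (T + M)` digits of `s` are the
coefficients of a polynomial of degree less than `k`, and the hash consists of the binary digits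
of its value at `x` from position `T` to `T + M - 1`. -/
def hashNat (T M k s x : ℕ) : ℕ :=
  (∑ j ∈ Finset.range k, s / (2 ^ (T + M)) ^ j % 2 ^ (T + M) * x ^ j) / 2 ^ T % 2 ^ M

theorem hashNat_lt (T M k s x : ℕ) : hashNat T M k s x < 2 ^ M := Nat.mod_lt _ (by positivity)

theorem hashNat_eq (T M k x : ℕ) (s : Fin ((2 ^ (T + M)) ^ k)) :
    hashNat T M k s x = (highBits T M (∑ j : Fin k,
      ((finFunctionFinEquiv.symm s j).val : ZMod (2 ^ (T + M))) * (x : ZMod (2 ^ (T + M))) ^ (j : ℕ))).val := by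
  have : (∑ j : Fin k, ((finFunctionFinEquiv.symm s j).val : ZMod (2 ^ (T + M))) *
      (x : ZMod (2 ^ (T + M))) ^ (j : ℕ)) =
      ((∑ j ∈ Finset.range k, s.val / (2 ^ (T + M)) ^ j % 2 ^ (T + M) * x ^ j : ℕ) :
        ZMod (2 ^ (T + M))) := by
    rw [← Fin.sum_univ_eq_sum_range (fun j => s.val / (2 ^ (T + M)) ^ j % 2 ^ (T + M) * x ^ j) k,
      Nat.cast_sum]
    refine Finset.sum_congr rfl fun j _ => ?_
    rw [finFunctionFinEquiv_symm_apply_val, Nat.cast_mul, Nat.cast_pow]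
  rw [this, highBits_natCast, ZMod.val_natCast, hashNat]

/-- The hash with a uniformly random seed is `k`-wise independent and uniform. -/
theorem sum_hashNat_eq {X : Type*} [Fintype X] [DecidableEq X]
    (enc : X → ℕ) (henc : Function.Injective enc)
    (L k M : ℕ) (hk : 0 < k) (hL : ∀ x, enc x < 2 ^ L)
    (F : (X → Fin (2 ^ M)) → ℂ) (hF : F ∈ juntaSpan X (Fin (2 ^ M)) ℂ k) :
    (∑ s ∈ Finset.range ((2 ^ (L * k + M)) ^ k),
        F (fun x => ⟨hashNat (L * k) M k s (enc x), hashNat_lt _ _ _ _ _⟩)) /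
        (((2 ^ (L * k + M)) ^ k : ℕ) : ℂ) =
      (∑ G, F G) / (Fintype.card (X → Fin (2 ^ M)) : ℂ) := by
  induction hF using Submodule.span_induction with
  | mem F h =>
    obtain ⟨S, hS, hF⟩ := h
    let e : ZMod (2 ^ M) ≃ Fin (2 ^ M) := (ZMod.finEquiv (2 ^ M)).symm.toEquiv
    let e' : ZMod (2 ^ (L * k + M)) ≃ Fin (2 ^ (L * k + M)) :=
      (ZMod.finEquiv (2 ^ (L * k + M))).symm.toEquiv
    have hval : ∀ (n : ℕ) [NeZero n] (v : ZMod n), ((ZMod.finEquiv n).symm v).val = v.val := by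
      intro n _ v
      cases n with
      | zero => exact absurd rfl (NeZero.ne 0)
      | succ n => rfl
    have h1 := sum_polyHash_eq enc henc L k M hk hL S hS
      (fun G => F fun x => e (G x)) (fun a b hab => hF fun x hx => congrArg e (hab x hx))
    have h2 : ∑ G : X → ZMod (2 ^ M), F (fun x => e (G x)) = ∑ G, F G :=
      Equiv.sum_comp (Equiv.arrowCongr (Equiv.refl X) e) F
    have h3 : ∑ s ∈ Finset.range ((2 ^ (L * k + M)) ^ k),
        F (fun x => ⟨hashNat (L * k) M k s (enc x), hashNat_lt _ _ _ _ _⟩) =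
        ∑ a : Fin k → ZMod (2 ^ (L * k + M)), F (fun x => e (highBits (L * k) M
          (∑ j, a j * (enc x : ZMod (2 ^ (L * k + M))) ^ (j : ℕ)))) := by
      rw [← Fin.sum_univ_eq_sum_range (fun s => F (fun x =>
          ⟨hashNat (L * k) M k s (enc x), hashNat_lt _ _ _ _ _⟩)) ((2 ^ (L * k + M)) ^ k),
        ← Equiv.sum_comp finFunctionFinEquiv,
        ← Equiv.sum_comp (Equiv.arrowCongr (Equiv.refl (Fin k)) e')]
      refine Finset.sum_congr rfl fun a _ => congrArg F (funext fun x => Fin.ext ?_)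
      simp only [hashNat_eq, Equiv.symm_apply_apply]
      simp only [e, RingEquiv.toEquiv_eq_coe, EquivLike.coe_coe, hval]
      congr 2
      refine Finset.sum_congr rfl fun j _ => ?_
      congr 1
      have : (Equiv.arrowCongr (Equiv.refl (Fin k)) e' a j).val = (a j).val := by
        simp only [Equiv.arrowCongr_apply, e', RingEquiv.toEquiv_eq_coe, Function.comp_apply,
          Equiv.refl_symm, Equiv.refl_apply, EquivLike.coe_coe, hval]
      rw [this, ZMod.natCast_zmod_val]
    rw [h3, ← h2, div_eq_div_iff (by exact_mod_cast (by positivity : (2 ^ (L * k + M)) ^ k ≠ 0))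
      (by exact_mod_cast Fintype.card_ne_zero)]
    simp only [nsmul_eq_mul, Fintype.card_fun, ZMod.card, Fintype.card_fin] at h1 ⊢
    rw [mul_comm, h1, mul_comm]
  | zero => simp
  | add F F' _ _ h h' => simp only [Pi.add_apply, Finset.sum_add_distrib, add_div, h, h']
  | smul a F _ h => simp only [Pi.smul_apply, smul_eq_mul, ← Finset.mul_sum, mul_div_assoc, h]

/-- Functions of few values of `H` are functions of few values of `G` when `H = r ∘ G`. -/
theorem comp_mem_juntaSpan {X C D V : Type*} [AddCommGroup V] [Module ℂ V] {k : ℕ}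
    {F : (X → C) → V} (hF : F ∈ juntaSpan X C V k) (r : D → C) :
    (fun G : X → D => F fun x => r (G x)) ∈ juntaSpan X D V k := by
  induction hF using Submodule.span_induction with
  | mem F h =>
    obtain ⟨S, hS, hF⟩ := h
    exact Submodule.subset_span ⟨S, hS, fun a b hab => hF fun x hx => congrArg r (hab x hx)⟩
  | zero => exact Submodule.zero_mem _
  | add f g _ _ hf hg => exact Submodule.add_mem _ hf hg
  | smul a f _ hf => exact Submodule.smul_mem _ a hf

/-- Half the average of a non-negative function of a uniformly random oracle is bounded by its
average over hash functions, if the function is in the span of functions of `k` values. -/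
theorem half_average_le_average_hash {X : Type*} [Fintype X] [DecidableEq X]
    (enc : X → ℕ) (henc : Function.Injective enc)
    (L k M C : ℕ) (hk : 0 < k) (hL : ∀ x, enc x < 2 ^ L)
    (hC : 0 < C) (h : 2 * (Fintype.card X * C) ≤ 2 ^ M)
    (F : (X → Fin C) → ℝ) (hF0 : ∀ H, 0 ≤ F H)
    (hF : (fun H => (F H : ℂ)) ∈ juntaSpan X (Fin C) ℂ k) :
    (1 / 2 : ℝ) * ((∑ H, F H) / (Fintype.card (X → Fin C) : ℝ)) ≤
      (∑ s ∈ Finset.range ((2 ^ (L * k + M)) ^ k),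
        F (fun x => ⟨hashNat (L * k) M k s (enc x) % C, Nat.mod_lt _ hC⟩)) /
        (((2 ^ (L * k + M)) ^ k : ℕ) : ℝ) := by
  refine (half_average_le_average_mod hC (Y := 2 ^ M) (by positivity) h F hF0).trans_eq ?_
  have h1 := sum_hashNat_eq enc henc L k M hk hL _
    (comp_mem_juntaSpan hF fun y : Fin (2 ^ M) => ⟨y.val % C, Nat.mod_lt _ hC⟩)
  exact_mod_cast h1.symm

/-! ### Reprogramming the oracle at a measured query -/

section measureReprogram

variable {P : SigmaProtocol} {q : ℕ} {E : Type*} [NormedAddCommGroup E] [InnerProductSpace ℂ E]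

/-- `queryOp` as a linear map. -/
def queryLin (H : P.Oracle) : AdvSpace P E →ₗ[ℂ] AdvSpace P E where
  toFun := queryOp H
  map_add' _ _ := rfl
  map_smul' _ _ := rfl

/-- The projection onto the content `x` of the register `X`. -/
def projX (x : BitVec P.instLen × BitVec P.comLen) : AdvSpace P E →ₗ[ℂ] AdvSpace P E where
  toFun ψ := WithLp.toLp 2 fun b => if (b.1, b.2.1) = x then ψ b else 0
  map_add' ψ φ := by ext b; by_cases h : (b.1, b.2.1) = x <;> simp [h]
  map_smul' r ψ := by ext b; by_cases h : (b.1, b.2.1) = x <;> simp [h]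

theorem projX_apply (x : BitVec P.instLen × BitVec P.comLen) (ψ : AdvSpace P E) (b : Basis P) :
    projX x ψ b = if (b.1, b.2.1) = x then ψ b else 0 := rfl

theorem queryLin_apply (H : P.Oracle) (ψ : AdvSpace P E) (b : Basis P) :
    queryLin H ψ b = ψ (b.1, b.2.1, b.2.2.1 ^^^ P.encChal (H (b.1, b.2.1)), b.2.2.2) := rfl

/-- One step of the adversary with oracle `H`: a query, and the unitary of index `j`. -/
def FSAdversary.step (A : FSAdversary P q E) (H : P.Oracle) (j : ℕ) :
    AdvSpace P E →ₗ[ℂ] AdvSpace P E :=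
  (if h : j < q then (A.U ⟨j, h⟩).toLinearEquiv.toLinearMap else LinearMap.id) ∘ₗ queryLin H

theorem FSAdversary.step_apply (A : FSAdversary P q E) (H : P.Oracle) (j : ℕ) (ψ : AdvSpace P E) :
    A.step H j ψ = A.applyU j (queryOp H ψ) := by
  unfold step applyU
  split <;> rfl

/-- The steps of index `j, …, j + r - 1` with oracle `H`. -/
def FSAdversary.evolve (A : FSAdversary P q E) (H : P.Oracle) :
    ℕ → ℕ → AdvSpace P E →ₗ[ℂ] AdvSpace P E
  | _, 0 => LinearMap.id
  | j, r + 1 => A.evolve H (j + 1) r ∘ₗ A.step H j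

theorem FSAdversary.evolve_succ (A : FSAdversary P q E) (H : P.Oracle) (j r : ℕ)
    (ψ : AdvSpace P E) : A.evolve H j (r + 1) ψ = A.evolve H (j + 1) r (A.step H j ψ) := rfl

theorem FSAdversary.evolve_stateAfter (A : FSAdversary P q E) (H : P.Oracle) (j r : ℕ) :
    A.evolve H j r (A.stateAfter H j) = A.stateAfter H (j + r) := by
  induction r generalizing j with
  | zero => rfl
  | succ r ih =>
    rw [evolve_succ, step_apply, ← add_assoc, Nat.add_right_comm]
    exact ih (j + 1)

/-- The steps of index `j, …, j + r - 1` with oracle `H'`, except that the first one uses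
`H` unless the flag is set. -/
def FSAdversary.resume (A : FSAdversary P q E) (H H' : P.Oracle) (flag : Bool) (j : ℕ) :
    ℕ → AdvSpace P E →ₗ[ℂ] AdvSpace P E
  | 0 => LinearMap.id
  | r + 1 => A.evolve H' (j + 1) r ∘ₗ A.step (if flag then H' else H) j

/-- The final state of the adversary if the register `X` is measured, with outcome `x`, right
before query `m / 2`, and the oracle answers are changed from `H` to `H'` from that query on if `m`
is odd, and from the next one on if `m` is even. The measurement happens at the end, for `m = 2 * q`. -/
def FSAdversary.measured (A : FSAdversary P q E) (H H' : P.Oracle)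
    (x : BitVec P.instLen × BitVec P.comLen) (m : ℕ) : AdvSpace P E :=
  A.resume H H' (decide (m % 2 = 1)) (m / 2) (q - m / 2) (projX x (A.stateAfter H (m / 2)))

theorem sum_range_two_mul_add_one {V : Type*} [AddCommMonoid V] (f : ℕ → V) (q : ℕ) :
    ∑ m ∈ Finset.range (2 * q + 1), f m =
      f (2 * q) + ∑ i ∈ Finset.range q, (f (2 * i) + f (2 * i + 1)) := by
  rw [Finset.sum_range_succ, add_comm]
  congr 1
  induction q with
  | zero => rfl
  | succ q ih => rw [mul_add, mul_one, Finset.sum_range_succ, Finset.sum_range_succ, ih,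
      Finset.sum_range_succ, add_assoc]

/-- If `H'` and `H` agree away from `x`, one step with either has the same effect on the part of the
state that does not query `x`. -/
theorem FSAdversary.step_sub_projX (A : FSAdversary P q E) {H H' : P.Oracle}
    {x : BitVec P.instLen × BitVec P.comLen} (hH : ∀ y, y ≠ x → H' y = H y) (j : ℕ)
    (ψ : AdvSpace P E) : A.step H' j (ψ - projX x ψ) = A.step H j (ψ - projX x ψ) := by
  rw [step_apply, step_apply]
  congr 1
  ext b
  change (ψ - projX x ψ) _ = (ψ - projX x ψ) _
  rw [PiLp.sub_apply, PiLp.sub_apply, projX_apply, projX_apply]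
  by_cases h : (b.1, b.2.1) = x
  · simp [h]
  · simp [h, hH _ h]

/-- The telescoping sum behind the measure-and-reprogram technique: the query-by-query change from
oracle `H` to `H'` only concerns the components of the state which query `x`. -/
theorem FSAdversary.stateAfter_eq_add_sum (A : FSAdversary P q E) {H H' : P.Oracle}
    {x : BitVec P.instLen × BitVec P.comLen} (hH : ∀ y, y ≠ x → H' y = H y) :
    A.stateAfter H' q = A.stateAfter H q + ∑ i ∈ Finset.range q,
      (A.measured H H' x (2 * i + 1) - A.measured H H' x (2 * i)) := by
  have key : ∀ i ∈ Finset.range q,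
      A.measured H H' x (2 * i + 1) - A.measured H H' x (2 * i) =
      A.evolve H' i (q - i) (A.stateAfter H i) -
        A.evolve H' (i + 1) (q - (i + 1)) (A.stateAfter H (i + 1)) := by
    intro i hi
    have hi := Finset.mem_range.1 hi
    obtain ⟨r, hr⟩ : ∃ r, q - i = r + 1 := ⟨q - i - 1, by omega⟩
    have h1 : (2 * i + 1) / 2 = i := by omega
    have h2 : (2 * i) / 2 = i := by omega
    have h3 : (2 * i + 1) % 2 = 1 := by omega
    have h4 : (2 * i) % 2 = 0 := by omega
    have h5 : q - (i + 1) = r := by omega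
    simp only [measured, h1, h2, h3, h4, hr, h5, evolve_succ, resume, LinearMap.comp_apply]
    simp only [decide_true, if_true, zero_ne_one, decide_false, Bool.false_eq_true, if_false]
    have h6 : A.stateAfter H (i + 1) = A.step H i (A.stateAfter H i) := (A.step_apply H i _).symm
    rw [h6, ← map_sub, ← map_sub]
    congr 1
    have h7 := A.step_sub_projX hH i (A.stateAfter H i)
    rw [map_sub, map_sub] at h7
    rw [sub_eq_sub_iff_sub_eq_sub] at h7
    exact h7.symm
  rw [Finset.sum_congr rfl key, Finset.sum_range_sub' (fun i => A.evolve H' i (q - i) (A.stateAfter H i))]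
  have h0 := A.evolve_stateAfter H' 0 q
  rw [zero_add] at h0
  simp only [Nat.sub_self, Nat.sub_zero]
  rw [show A.evolve H' q 0 (A.stateAfter H q) = A.stateAfter H q from rfl,
    show A.stateAfter H 0 = A.stateAfter H' 0 from rfl, h0]
  abel

theorem FSAdversary.norm_stateAfter_sq_le (A : FSAdversary P q E) {H H' : P.Oracle}
    {x : BitVec P.instLen × BitVec P.comLen} (hH : ∀ y, y ≠ x → H' y = H y)
    (b : Basis P) (hb : (b.1, b.2.1) = x) :
    ‖A.stateAfter H' q b‖ ^ 2 ≤
      (2 * q + 1) * ∑ m ∈ Finset.range (2 * q + 1), ‖A.measured H H' x m b‖ ^ 2 := by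
  -- The first summand of the telescoping sum is the variant in which `X` is measured at the end.
  have h1 : A.stateAfter H q b = A.measured H H' x (2 * q) b := by
    have h2 : (2 * q) / 2 = q := by omega
    rw [measured, h2, Nat.sub_self]
    change _ = projX x (A.stateAfter H q) b
    rw [projX_apply, if_pos hb]
  have h2 : ‖A.stateAfter H' q b‖ ≤ ∑ m ∈ Finset.range (2 * q + 1), ‖A.measured H H' x m b‖ := by
    rw [A.stateAfter_eq_add_sum hH, sum_range_two_mul_add_one, PiLp.add_apply, ← h1]
    refine (norm_add_le _ _).trans (add_le_add le_rfl ?_)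
    have h3 : (∑ i ∈ Finset.range q,
        (A.measured H H' x (2 * i + 1) - A.measured H H' x (2 * i))) b =
        ∑ i ∈ Finset.range q,
          (A.measured H H' x (2 * i + 1) b - A.measured H H' x (2 * i) b) := by
      rw [WithLp.ofLp_sum, Finset.sum_apply]
      rfl
    rw [h3]
    refine norm_sum_le_of_le _ fun i _ => (norm_sub_le _ _).trans_eq (add_comm _ _)
  calc ‖A.stateAfter H' q b‖ ^ 2
      ≤ (∑ m ∈ Finset.range (2 * q + 1), ‖A.measured H H' x m b‖) ^ 2 :=
        pow_le_pow_left₀ (norm_nonneg _) h2 2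
    _ ≤ _ := by
      refine (sq_sum_le_card_mul_sum_sq).trans_eq ?_
      simp

/-! ### The state depends on the oracle through few values -/

/-- For each content `y` of the register `X`, a query depends on `H` through `H y`. -/
theorem queryLin_eq_sum (H : P.Oracle) (ψ : AdvSpace P E) :
    queryLin H ψ = ∑ y, (projX y ∘ₗ queryLin (fun _ => H y)) ψ := by
  ext b
  rw [WithLp.ofLp_sum, Finset.sum_apply, Finset.sum_eq_single (b.1, b.2.1)]
  · simp [projX_apply, queryLin_apply]
  · intro y _ hy
    simp [projX_apply, Ne.symm hy]
  · simp

/-- One more query costs one more value, also if the answers are changed locally, by `R`. -/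
theorem FSAdversary.step_mem_juntaSpan (A : FSAdversary P q E) {k : ℕ}
    {f : P.Oracle → AdvSpace P E} (hf : f ∈ juntaSpan _ P.Chal (AdvSpace P E) k) (j : ℕ)
    (R : P.Oracle → P.Oracle) (r : BitVec P.instLen × BitVec P.comLen → P.Chal → P.Chal)
    (hR : ∀ H y, R H y = r y (H y)) :
    (fun H => A.step (R H) j (f H)) ∈ juntaSpan _ P.Chal (AdvSpace P E) (k + 1) := by
  unfold step
  simp only [LinearMap.comp_apply]
  refine map_mem_juntaSpan ?_ _
  simp only [queryLin_eq_sum, hR]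
  have : (fun H : P.Oracle => ∑ y, (projX y ∘ₗ queryLin (fun _ => r y (H y))) (f H)) =
      ∑ y, fun H : P.Oracle => (projX y ∘ₗ queryLin (fun _ => r y (H y))) (f H) := by
    funext H
    rw [Finset.sum_apply]
  rw [this]
  exact Submodule.sum_mem _ fun y _ =>
    query_mem_juntaSpan hf y fun c => projX y ∘ₗ queryLin (fun _ => r y c)

theorem FSAdversary.evolve_mem_juntaSpan (A : FSAdversary P q E) {k : ℕ}
    {f : P.Oracle → AdvSpace P E} (hf : f ∈ juntaSpan _ P.Chal (AdvSpace P E) k) (j s : ℕ)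
    (R : P.Oracle → P.Oracle) (r : BitVec P.instLen × BitVec P.comLen → P.Chal → P.Chal)
    (hR : ∀ H y, R H y = r y (H y)) :
    (fun H => A.evolve (R H) j s (f H)) ∈ juntaSpan _ P.Chal (AdvSpace P E) (k + s) := by
  induction s generalizing j k f with
  | zero => exact hf
  | succ s ih =>
    have := ih (A.step_mem_juntaSpan hf j R r hR) (j + 1)
    rwa [add_assoc, add_comm 1 s] at this

theorem FSAdversary.stateAfter_mem_juntaSpan (A : FSAdversary P q E) (j : ℕ) :
    (fun H => A.stateAfter H j) ∈ juntaSpan _ P.Chal (AdvSpace P E) j := by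
  have := A.evolve_mem_juntaSpan (const_mem_juntaSpan 0 A.init) 0 j id (fun _ c => c)
    (fun _ _ => rfl)
  rw [zero_add] at this
  convert this using 2 with H
  have h := A.evolve_stateAfter H 0 j
  rw [zero_add] at h
  exact h.symm

/-- The final state depends on `H` through one value per query, so through `q` values in all. -/
theorem FSAdversary.measured_mem_juntaSpan (A : FSAdversary P q E)
    (x : BitVec P.instLen × BitVec P.comLen) (c : P.Chal) {m : ℕ} (hm : m ≤ 2 * q) :
    (fun H => A.measured H (Function.update H x c) x m) ∈
      juntaSpan _ P.Chal (AdvSpace P E) q := by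
  have hu : ∀ (H : P.Oracle) y, Function.update H x c y = (if y = x then c else H y) :=
    fun H y => Function.update_apply H x c y
  have h0 := map_mem_juntaSpan (A.stateAfter_mem_juntaSpan (m / 2)) (projX x)
  unfold measured
  generalize hi : m / 2 = i at h0 ⊢
  rcases hr : q - i with _ | r
  · exact juntaSpan_mono (by omega) h0
  · have hq : q = i + 1 + r := by omega
    simp only [resume, LinearMap.comp_apply]
    have h1 := A.step_mem_juntaSpan h0 i
      (fun H => if decide (m % 2 = 1) then Function.update H x c else H)
      (fun y d => if decide (m % 2 = 1) then (if y = x then c else d) else d)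
      (fun H y => by split <;> simp [hu])
    have h2 := A.evolve_mem_juntaSpan h1 (i + 1) r (fun H => Function.update H x c)
      (fun y d => if y = x then c else d) hu
    exact juntaSpan_mono hq.ge h2

/-! ### The measure-and-reprogram bound -/

/-- Drawing a function at random and overwriting its value at `x` by a random one gives a random
function. -/
theorem sum_sum_update {X C V : Type*} [Fintype X] [DecidableEq X] [Fintype C]
    [AddCommMonoid V] (x : X) (f : (X → C) → C → V) :
    ∑ H : X → C, ∑ c, f (Function.update H x c) c = Fintype.card C • ∑ H : X → C, f H (H x) := by
  rw [← Fintype.sum_prod_type' (f := fun H c => f (Function.update H x c) c)]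
  -- Exchanging `H x` and `c` is an involution.
  let e : (X → C) × C ≃ (X → C) × C :=
    { toFun := fun p => (Function.update p.1 x p.2, p.1 x)
      invFun := fun p => (Function.update p.1 x p.2, p.1 x)
      left_inv := fun p => by simp
      right_inv := fun p => by simp }
  rw [← Equiv.sum_comp e.symm]
  simp only [e, Equiv.coe_fn_symm_mk, Function.update_idem, Function.update_eq_self]
  rw [Fintype.sum_prod_type]
  simp [Finset.smul_sum]

/-- The probability that, in the variant `m` of the measure-and-reprogram experiment with oracle `H`,
the outcome is `x` and the final measurement finds `x` once more and a response that is accepted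
for the challenge `c`. -/
def FSAdversary.measuredWeight (A : FSAdversary P q E) (H : P.Oracle)
    (x : BitVec P.instLen × BitVec P.comLen) (c : P.Chal) (m : ℕ) : ℝ :=
  ∑ b : Basis P, if (b.1, b.2.1) = x ∧ P.V x.1 x.2 c b.2.2.2 = true then
    ‖A.measured H (Function.update H x c) x m b‖ ^ 2 else 0

theorem FSAdversary.measuredWeight_nonneg (A : FSAdversary P q E) (H : P.Oracle)
    (x : BitVec P.instLen × BitVec P.comLen) (c : P.Chal) (m : ℕ) :
    0 ≤ A.measuredWeight H x c m :=
  Finset.sum_nonneg fun b _ => by split <;> positivity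

theorem FSAdversary.measuredWeight_mem_juntaSpan (A : FSAdversary P q E)
    (x : BitVec P.instLen × BitVec P.comLen) (c : P.Chal) {m : ℕ} (hm : m ≤ 2 * q) :
    (fun H => (A.measuredWeight H x c m : ℂ)) ∈ juntaSpan _ P.Chal ℂ (2 * q) := by
  have : (fun H => (A.measuredWeight H x c m : ℂ)) = ∑ b : Basis P,
      if (b.1, b.2.1) = x ∧ P.V x.1 x.2 c b.2.2.2 = true then
        fun H => ((‖A.measured H (Function.update H x c) x m b‖ ^ 2 : ℝ) : ℂ) else 0 := by
    funext H
    rw [Finset.sum_apply, measuredWeight, Complex.ofReal_sum]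
    refine Finset.sum_congr rfl fun b _ => ?_
    split <;> simp
  rw [this]
  refine Submodule.sum_mem _ fun b _ => ?_
  split
  · exact norm_sq_mem_juntaSpan (map_mem_juntaSpan (A.measured_mem_juntaSpan x c hm)
      (PiLp.projₗ (𝕜 := ℂ) 2 (fun _ : Basis P => E) b))
  · exact Submodule.zero_mem _

/-- Measure-and-reprogram for a uniformly random oracle. -/
theorem FSAdversary.forgeProb_le (A : FSAdversary P q E) (x₀ : BitVec P.instLen) :
    A.forgeProb x₀ ≤ (2 * q + 1) * ((∑ c : P.Chal, ∑ a, ∑ m ∈ Finset.range (2 * q + 1),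
      (∑ H : P.Oracle, A.measuredWeight H (x₀, a) c m) / (Fintype.card P.Oracle : ℝ)) /
        (P.chalCard : ℝ)) := by
  have hC : (0 : ℝ) < P.chalCard := by exact_mod_cast P.chalCard_pos
  let f : BitVec P.comLen → P.Oracle → P.Chal → ℝ := fun a H c =>
    ∑ b : Basis P, if (b.1, b.2.1) = (x₀, a) ∧ P.V x₀ a c b.2.2.2 = true then
      ‖A.stateAfter H q b‖ ^ 2 else 0
  have h1 : ∑ H : P.Oracle, ∑ b : Basis P,
      (if b.1 = x₀ ∧ P.V b.1 b.2.1 (H (b.1, b.2.1)) b.2.2.2 = true then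
        ‖A.stateAfter H q b‖ ^ 2 else 0) = ∑ a, ∑ H : P.Oracle, f a H (H (x₀, a)) := by
    refine Eq.trans (Finset.sum_congr rfl fun H _ => ?_) Finset.sum_comm
    refine Eq.trans (Finset.sum_congr rfl fun b _ => ?_) Finset.sum_comm
    rw [Finset.sum_eq_single b.2.1]
    · by_cases h : b.1 = x₀
      · subst h; simp
      · simp [h]
    · intro a _ ha
      simp [Ne.symm ha]
    · simp
  have h2 : ∀ a, ∑ H : P.Oracle, f a H (H (x₀, a)) =
      (∑ c, ∑ H : P.Oracle, f a (Function.update H (x₀, a) c) c) / P.chalCard := by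
    intro a
    have := sum_sum_update (x₀, a) (f a)
    rw [Finset.sum_comm, Fintype.card_fin, nsmul_eq_mul] at this
    rw [this]
    field_simp
  have h3 : ∀ a c (H : P.Oracle), f a (Function.update H (x₀, a) c) c ≤
      (2 * q + 1) * ∑ m ∈ Finset.range (2 * q + 1), A.measuredWeight H (x₀, a) c m := by
    intro a c H
    simp only [f, measuredWeight]
    rw [Finset.sum_comm, Finset.mul_sum]
    refine Finset.sum_le_sum fun b _ => ?_
    split
    · rename_i h
      exact A.norm_stateAfter_sq_le (fun y hy => Function.update_of_ne hy _ _) b h.1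
    · simp
  have hN : (0 : ℝ) < Fintype.card P.Oracle := by
    have : Nonempty P.Oracle := ⟨fun _ => ⟨0, P.chalCard_pos⟩⟩
    exact_mod_cast Fintype.card_pos
  unfold forgeProb
  rw [h1, Finset.sum_congr rfl fun a _ => h2 a, ← Finset.sum_div, Finset.sum_comm]
  calc (∑ c : P.Chal, ∑ a, ∑ H : P.Oracle, f a (Function.update H (x₀, a) c) c) / P.chalCard /
        (Fintype.card P.Oracle : ℝ)
      ≤ (∑ c : P.Chal, ∑ a, ∑ H : P.Oracle, (2 * q + 1) *
          ∑ m ∈ Finset.range (2 * q + 1), A.measuredWeight H (x₀, a) c m) / P.chalCard /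
        (Fintype.card P.Oracle : ℝ) := by
        gcongr with c _ a _ H _
        exact h3 a c H
    _ = _ := by
      simp only [← Finset.mul_sum, ← Finset.sum_div]
      have h4 : ∀ c a, ∑ H : P.Oracle, ∑ m ∈ Finset.range (2 * q + 1),
          A.measuredWeight H (x₀, a) c m = ∑ m ∈ Finset.range (2 * q + 1), ∑ H : P.Oracle,
          A.measuredWeight H (x₀, a) c m := fun c a => Finset.sum_comm
      simp only [h4]
      field_simp

/-- The content of the register `X` as one number. -/
def encX (P : SigmaProtocol) (x : BitVec P.instLen × BitVec P.comLen) : ℕ :=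
  x.1.toNat * 2 ^ P.comLen + x.2.toNat

theorem encX_injective (P : SigmaProtocol) : Function.Injective (encX P) := by
  rintro ⟨x, a⟩ ⟨y, b⟩ h
  simp only [encX] at h
  have ha := a.isLt
  have hb := b.isLt
  have h1 : a.toNat = b.toNat := by
    have := congrArg (· % 2 ^ P.comLen) h
    simpa [Nat.mul_add_mod', Nat.mod_eq_of_lt ha, Nat.mod_eq_of_lt hb] using this
  rw [h1] at h
  have h2 : x.toNat = y.toNat :=
    Nat.eq_of_mul_eq_mul_right (by positivity) (Nat.add_right_cancel h)
  rw [BitVec.eq_of_toNat_eq h1, BitVec.eq_of_toNat_eq h2]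

theorem encX_lt (P : SigmaProtocol) (x : BitVec P.instLen × BitVec P.comLen) :
    encX P x < 2 ^ (P.instLen + P.comLen) := by
  have h1 := x.1.isLt
  have h2 := x.2.isLt
  rw [pow_add, encX]
  calc x.1.toNat * 2 ^ P.comLen + x.2.toNat < x.1.toNat * 2 ^ P.comLen + 2 ^ P.comLen := by omega
    _ = (x.1.toNat + 1) * 2 ^ P.comLen := by ring
    _ ≤ _ := Nat.mul_le_mul_right _ h1

/-- The number of low binary digits that the hash function for `q` queries discards. -/
def lowLen (P : SigmaProtocol) (q : ℕ) : ℕ := (P.instLen + P.comLen) * (2 * q)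

/-- The number of binary digits of the hash before it is reduced modulo `|C|`. -/
def highLen (P : SigmaProtocol) : ℕ := P.instLen + P.comLen + P.chalLen + 1

/-- The number of binary digits of a seed. -/
def seedLen (P : SigmaProtocol) (q : ℕ) : ℕ := (lowLen P q + highLen P) * (2 * q)

/-- The pseudorandom oracle with seed `s`. -/
def hashOracle (P : SigmaProtocol) (q s : ℕ) : P.Oracle := fun x =>
  ⟨hashNat (lowLen P q) (highLen P) (2 * q) s (encX P x) % P.chalCard,
    Nat.mod_lt _ P.chalCard_pos⟩

theorem half_average_le_average_hashOracle (hq : 1 ≤ q) (F : P.Oracle → ℝ) (hF0 : ∀ H, 0 ≤ F H)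
    (hF : (fun H => (F H : ℂ)) ∈ juntaSpan _ P.Chal ℂ (2 * q)) :
    (1 / 2 : ℝ) * ((∑ H, F H) / (Fintype.card P.Oracle : ℝ)) ≤
      (∑ s ∈ Finset.range (2 ^ seedLen P q), F (hashOracle P q s)) / 2 ^ seedLen P q := by
  have hcard : Fintype.card (BitVec P.instLen × BitVec P.comLen) =
      2 ^ (P.instLen + P.comLen) := by
    rw [Fintype.card_prod, pow_add]
    congr 1 <;> exact (Fintype.ofEquiv_card _).trans (Fintype.card_fin _)
  have h := half_average_le_average_hash (encX P) (encX_injective P) (P.instLen + P.comLen)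
    (2 * q) (highLen P) P.chalCard (by omega) (encX_lt P) P.chalCard_pos (by
      rw [hcard, highLen, pow_succ, pow_add _ (P.instLen + P.comLen), mul_comm]
      exact Nat.mul_le_mul_right _ (Nat.mul_le_mul_left _ P.chalCard_le)) F hF0 hF
  rw [← pow_mul] at h
  exact_mod_cast h

/-- Measure-and-reprogram for the pseudorandom oracle. -/
theorem FSAdversary.forgeProb_le_hashOracle (A : FSAdversary P q E) (hq : 1 ≤ q)
    (x₀ : BitVec P.instLen) :
    A.forgeProb x₀ ≤ 2 * (2 * q + 1) * ((∑ c : P.Chal, ∑ a, ∑ m ∈ Finset.range (2 * q + 1),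
      (∑ s ∈ Finset.range (2 ^ seedLen P q), A.measuredWeight (hashOracle P q s) (x₀, a) c m) /
        2 ^ seedLen P q) / (P.chalCard : ℝ)) := by
  refine (A.forgeProb_le x₀).trans ?_
  rw [mul_comm (2 : ℝ) (2 * q + 1), mul_assoc]
  refine mul_le_mul_of_nonneg_left ?_ (by positivity)
  rw [← mul_div_assoc]
  refine div_le_div_of_nonneg_right ?_ (by positivity)
  simp only [Finset.mul_sum]
  refine Finset.sum_le_sum fun c _ => Finset.sum_le_sum fun a _ => Finset.sum_le_sum fun m hm => ?_
  have := half_average_le_average_hashOracle hq (fun H => A.measuredWeight H (x₀, a) c m)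
    (fun H => A.measuredWeight_nonneg H _ c m)
    (A.measuredWeight_mem_juntaSpan (x₀, a) c (by have := Finset.mem_range.1 hm; omega))
  linarith

end measureReprogram

/-! ### Classical programs: running time -/

/-- All variables of the store have at most `B` bits. -/
def Store.Bounded (B : ℕ) (σ : Store) : Prop := ∀ v, σ v < 2 ^ B

theorem Store.Bounded.update {B : ℕ} {σ : Store} (h : Store.Bounded B σ) {v n : ℕ}
    (hn : n < 2 ^ B) : Store.Bounded B (Function.update σ v n) := by
  intro w
  rw [Function.update_apply]
  split
  · exact hn
  · exact h w

theorem one_lt_two_pow_of_one_le {B : ℕ} (hB : 1 ≤ B) : 1 < 2 ^ B :=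
  Nat.one_lt_two_pow (by omega)

/-- A factor `w` such that the value of the expression has at most `w * B` bits if all variables
have at most `B ≥ 1` bits. -/
def Expr.sizeFactor : Expr → ℕ
  | lit n => Nat.size n
  | var _ => 1
  | add e₁ e₂ => e₁.sizeFactor + e₂.sizeFactor + 1
  | sub e₁ _ => e₁.sizeFactor
  | mul e₁ e₂ => e₁.sizeFactor + e₂.sizeFactor
  | div e₁ _ => e₁.sizeFactor
  | mod e₁ _ => e₁.sizeFactor

/-- A factor `w` such that evaluating the expression costs at most `w * B ^ 2` if all variables have
at most `B ≥ 1` bits. -/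
def Expr.costFactor : Expr → ℕ
  | lit n => Nat.size n + 1
  | var _ => 2
  | add e₁ e₂ => e₁.costFactor + e₂.costFactor + (e₁.sizeFactor + 1) * (e₂.sizeFactor + 1)
  | sub e₁ e₂ => e₁.costFactor + e₂.costFactor + (e₁.sizeFactor + 1) * (e₂.sizeFactor + 1)
  | mul e₁ e₂ => e₁.costFactor + e₂.costFactor + (e₁.sizeFactor + 1) * (e₂.sizeFactor + 1)
  | div e₁ e₂ => e₁.costFactor + e₂.costFactor + (e₁.sizeFactor + 1) * (e₂.sizeFactor + 1)
  | mod e₁ e₂ => e₁.costFactor + e₂.costFactor + (e₁.sizeFactor + 1) * (e₂.sizeFactor + 1)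

theorem Expr.eval_lt {B : ℕ} (hB : 1 ≤ B) {σ : Store} (h : Store.Bounded B σ) (e : Expr) :
    e.eval σ < 2 ^ (e.sizeFactor * B) := by
  induction e with
  | lit n =>
    exact (Nat.lt_size_self n).trans_le
      (Nat.pow_le_pow_right (by norm_num) (Nat.le_mul_of_pos_right _ hB))
  | var v => simpa [eval, sizeFactor] using h v
  | add e₁ e₂ h₁ h₂ =>
    have h3 : 2 ^ (e₁.sizeFactor * B) ≤ 2 ^ ((e₁.sizeFactor + e₂.sizeFactor) * B) :=
      Nat.pow_le_pow_right (by norm_num) (Nat.mul_le_mul_right _ (by omega))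
    have h4 : 2 ^ (e₂.sizeFactor * B) ≤ 2 ^ ((e₁.sizeFactor + e₂.sizeFactor) * B) :=
      Nat.pow_le_pow_right (by norm_num) (Nat.mul_le_mul_right _ (by omega))
    have h5 : 2 ^ ((e₁.sizeFactor + e₂.sizeFactor) * B + 1) ≤
        2 ^ ((e₁.sizeFactor + e₂.sizeFactor + 1) * B) :=
      Nat.pow_le_pow_right (by norm_num) (by rw [add_mul _ 1 B]; omega)
    rw [pow_succ] at h5
    simp only [eval, sizeFactor]
    omega
  | sub e₁ e₂ h₁ _ => exact (Nat.sub_le _ _).trans_lt h₁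
  | mul e₁ e₂ h₁ h₂ =>
    simp only [eval, sizeFactor]
    rw [add_mul, pow_add]
    exact Nat.mul_lt_mul'' h₁ h₂
  | div e₁ e₂ h₁ _ => exact (Nat.div_le_self _ _).trans_lt h₁
  | mod e₁ e₂ h₁ _ => exact (Nat.mod_le _ _).trans_lt h₁

theorem opCost_le {B : ℕ} (hB : 1 ≤ B) {a b w₁ w₂ : ℕ} (ha : a < 2 ^ (w₁ * B))
    (hb : b < 2 ^ (w₂ * B)) : opCost a b ≤ (w₁ + 1) * (w₂ + 1) * B ^ 2 := by
  have h1 : Nat.size a ≤ w₁ * B := Nat.size_le.2 ha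
  have h2 : Nat.size b ≤ w₂ * B := Nat.size_le.2 hb
  calc opCost a b ≤ ((w₁ + 1) * B) * ((w₂ + 1) * B) :=
        Nat.mul_le_mul (by rw [add_mul]; omega) (by rw [add_mul]; omega)
    _ = _ := by ring

theorem Expr.cost_le {B : ℕ} (hB : 1 ≤ B) {σ : Store} (h : Store.Bounded B σ) (e : Expr) :
    e.cost σ ≤ e.costFactor * B ^ 2 := by
  have hB2 : B ≤ B ^ 2 := by nlinarith
  induction e with
  | lit n => exact Nat.le_mul_of_pos_right _ (by omega)
  | var v =>
    have := Nat.size_le.2 (h v)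
    simp only [cost, costFactor]
    omega
  | add e₁ e₂ h₁ h₂ | sub e₁ e₂ h₁ h₂ | mul e₁ e₂ h₁ h₂ | div e₁ e₂ h₁ h₂ | mod e₁ e₂ h₁ h₂ =>
    have := opCost_le hB (eval_lt hB h e₁) (eval_lt hB h e₂)
    simp only [cost, costFactor, add_mul _ _ (B ^ 2)]
    omega

/-- Started in the store `σ`, the program `c` ends in `σ'` after at most `τ` steps. -/
def Code.Runs (c : Code) (σ σ' : Store) (τ : ℕ) : Prop :=
  ∀ t, (c.run (σ, t)).1 = σ' ∧ (c.run (σ, t)).2 ≤ t + τ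

namespace Code

theorem Runs.mono {c : Code} {σ σ' : Store} {τ τ' : ℕ} (h : c.Runs σ σ' τ) (hτ : τ ≤ τ') :
    c.Runs σ σ' τ' := fun t => ⟨(h t).1, (h t).2.trans (by omega)⟩

theorem Runs.seq {c₁ c₂ : Code} {σ σ' σ'' : Store} {τ₁ τ₂ : ℕ} (h₁ : c₁.Runs σ σ' τ₁)
    (h₂ : c₂.Runs σ' σ'' τ₂) : (Code.seq c₁ c₂).Runs σ σ'' (τ₁ + τ₂) := by
  intro t
  obtain ⟨h3, h4⟩ := h₁ t
  obtain ⟨h5, h6⟩ := h₂ (c₁.run (σ, t)).2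
  rw [← h3] at h5 h6
  exact ⟨h5, h6.trans (by omega)⟩

theorem runs_skip {σ : Store} {τ : ℕ} (hτ : 1 ≤ τ) : skip.Runs σ σ τ :=
  fun t => ⟨rfl, by simp only [run]; omega⟩

theorem runs_assign {B : ℕ} (hB : 1 ≤ B) {σ : Store} (h : Store.Bounded B σ) (v : ℕ) (e : Expr)
    {K n : ℕ} (hn : e.eval σ = n) (hK : e.costFactor + 1 ≤ K) :
    (assign v e).Runs σ (Function.update σ v n) (K * B ^ 2) := by
  have h1 := Expr.cost_le hB h e
  have h2 : (e.costFactor + 1) * B ^ 2 ≤ K * B ^ 2 := Nat.mul_le_mul_right _ hK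
  have h3 : 1 ≤ B ^ 2 := Nat.one_le_pow _ _ hB
  rw [add_mul] at h2
  subst hn
  exact fun t => ⟨rfl, by simp only [run]; omega⟩

theorem runs_loop {B : ℕ} (hB : 1 ≤ B) (e : Expr) (c : Code) {K τ n : ℕ} (f : ℕ → Store)
    (h : Store.Bounded B (f 0)) (hn : e.eval (f 0) = n) (hK : e.costFactor + 1 ≤ K)
    (hc : ∀ i < n, c.Runs (f i) (f (i + 1)) τ) :
    (loop e c).Runs (f 0) (f n) (K * B ^ 2 + n * (τ + 1)) := by
  have h1 := Expr.cost_le hB h e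
  have h2 : (e.costFactor + 1) * B ^ 2 ≤ K * B ^ 2 := Nat.mul_le_mul_right _ hK
  have h3 : 1 ≤ B ^ 2 := Nat.one_le_pow _ _ hB
  rw [add_mul] at h2
  intro t
  simp only [run, hn]
  have key : ∀ i ≤ n, ((fun s : Store × ℕ => c.run (s.1, s.2 + 1))^[i]
      (f 0, t + e.cost (f 0) + 1)).1 = f i ∧ ((fun s : Store × ℕ => c.run (s.1, s.2 + 1))^[i]
      (f 0, t + e.cost (f 0) + 1)).2 ≤ t + e.cost (f 0) + 1 + i * (τ + 1) := by
    intro i hi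
    induction i with
    | zero => exact ⟨rfl, by simp⟩
    | succ i ih =>
      rw [Function.iterate_succ_apply']
      obtain ⟨h4, h5⟩ := ih (by omega)
      obtain ⟨h6, h7⟩ := hc i (by omega) (((fun s : Store × ℕ => c.run (s.1, s.2 + 1))^[i]
        (f 0, t + e.cost (f 0) + 1)).2 + 1)
      rw [← h4] at h6 h7
      refine ⟨by rw [h6], h7.trans ?_⟩
      rw [add_mul i 1]
      omega
  obtain ⟨h4, h5⟩ := key n le_rfl
  exact ⟨h4, h5.trans (by omega)⟩

theorem runs_ite {B : ℕ} (hB : 1 ≤ B) {σ σ' : Store} (h : Store.Bounded B σ) (e : Expr)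
    (c₁ c₂ : Code) {K τ : ℕ} (hK : e.costFactor + 1 ≤ K)
    (h₁ : e.eval σ ≠ 0 → c₁.Runs σ σ' τ) (h₂ : e.eval σ = 0 → c₂.Runs σ σ' τ) :
    (ite e c₁ c₂).Runs σ σ' (K * B ^ 2 + τ) := by
  have h1 := Expr.cost_le hB h e
  have h2 : (e.costFactor + 1) * B ^ 2 ≤ K * B ^ 2 := Nat.mul_le_mul_right _ hK
  have h3 : 1 ≤ B ^ 2 := Nat.one_le_pow _ _ hB
  rw [add_mul] at h2
  intro t
  simp only [run]
  by_cases h0 : e.eval σ ≠ 0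
  · rw [if_pos h0]
    have := h₁ h0 (t + e.cost σ + 1)
    exact ⟨this.1, this.2.trans (by omega)⟩
  · rw [if_neg h0]
    have := h₂ (not_not.1 h0) (t + e.cost σ + 1)
    exact ⟨this.1, this.2.trans (by omega)⟩

/-! ### Classical programs: powers of two and the pseudorandom oracle -/

/-- Set the variable `v` to `2 ^ e`. -/
def pow2 (v : ℕ) (e : Expr) : Code :=
  seq (assign v (.lit 1)) (loop e (assign v (.mul (.var v) (.lit 2))))

theorem runs_pow2 {B : ℕ} (hB : 1 ≤ B) {σ : Store} (h : Store.Bounded B σ) (v : ℕ) (e : Expr)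
    {K n : ℕ} (hn : e.eval (Function.update σ v 1) = n) (hnB : n < B) (hK : e.costFactor + 20 ≤ K) :
    (pow2 v e).Runs σ (Function.update σ v (2 ^ n)) ((n + 2) * (2 * K * B ^ 2)) := by
  have h1 := runs_assign hB h v (.lit 1) (K := K) (n := 1) rfl
    (by simp [Expr.costFactor]; omega)
  have hf : ∀ i, i < B → Store.Bounded B (Function.update σ v (2 ^ i)) := fun i hi =>
    h.update (Nat.pow_lt_pow_right (by norm_num) hi)
  have h2 := runs_loop hB e (assign v (.mul (.var v) (.lit 2))) (K := K) (n := n) (τ := K * B ^ 2)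
    (fun i => Function.update σ v (2 ^ i)) (hf 0 (by omega)) (by simpa using hn) (by omega) (by
      intro i hi
      have := runs_assign hB (hf i (by omega)) v (.mul (.var v) (.lit 2)) (K := K)
        (n := 2 ^ (i + 1)) (by simp [Expr.eval, pow_succ])
        (by simp [Expr.costFactor, Expr.sizeFactor, show Nat.size 2 = 2 by decide]; omega)
      simpa using this)
  refine (h1.seq h2).mono ?_
  have h3 : 1 ≤ K * B ^ 2 := Nat.mul_pos (by omega) (by positivity)
  nlinarith

/-- The pseudorandom oracle, for the registers in the variables `10` and `11`; once the flag in
variable `26` is set, the answer to the query in the variables `6` and `7` is the challenge in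
variable `8`. The seed is in variable `23`, and the variables `20`, `21`, `22` hold the powers of two
with exponents `P.comLen`, `lowLen P q` and `highLen P`. -/
def oracle : Code :=
  seq (assign 33 (.add (.mul (.var 10) (.var 20)) (.var 11))) <|
  seq (assign 30 (.lit 0)) <|
  seq (assign 31 (.lit 1)) <|
  seq (assign 32 (.var 23)) <|
  seq (loop (.mul (.lit 2) (.var 5)) <|
    seq (assign 30 (.add (.var 30)
      (.mul (.mod (.var 32) (.mul (.var 21) (.var 22))) (.var 31)))) <|
    seq (assign 31 (.mul (.var 31) (.var 33)))
      (assign 32 (.div (.var 32) (.mul (.var 21) (.var 22))))) <|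
  seq (assign 15 (.mod (.mod (.div (.var 30) (.var 21)) (.var 22)) (.var 4)))
    (ite (.var 26)
      (ite (.add (.add (.sub (.var 10) (.var 6)) (.sub (.var 6) (.var 10)))
          (.add (.sub (.var 11) (.var 7)) (.sub (.var 7) (.var 11))))
        skip (assign 15 (.var 8)))
      skip)

/-- The exponents `T` and `M` determine `D = 2 ^ (T + M)`; the loop keeps the partial value of the
polynomial in variable `30`, the power of `x` in `31`, and the remaining digits of the seed in `32`. -/
theorem runs_oracle {B : ℕ} {σ : Store} (h : Store.Bounded B σ) {q m L T M : ℕ}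
    (hq : σ 5 = q) (hm : σ 20 = 2 ^ m) (hT : σ 21 = 2 ^ T) (hM : σ 22 = 2 ^ M)
    (hL : σ 10 * 2 ^ m + σ 11 < 2 ^ L) (hLB : L * (2 * q) + (T + M) + 2 * q + L < B) :
    ∃ σ', oracle.Runs σ σ' ((2 * q + 1) * (1000 * B ^ 2)) ∧
      σ' 15 = if σ 26 ≠ 0 ∧ σ 10 = σ 6 ∧ σ 11 = σ 7 then σ 8 else
        hashNat T M (2 * q) (σ 23) (σ 10 * 2 ^ m + σ 11) % σ 4 := by
  have hB : 1 ≤ B := by omega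
  set x := σ 10 * 2 ^ m + σ 11 with hx
  set s := σ 23 with hs
  set D := 2 ^ (T + M) with hD
  let acc : ℕ → ℕ := fun i => ∑ j ∈ Finset.range i, s / D ^ j % D * x ^ j
  let f : ℕ → Store := fun i => Function.update (Function.update (Function.update
    (Function.update σ 33 x) 30 (acc i)) 31 (x ^ i)) 32 (s / D ^ i)
  have hpow : ∀ {n}, n < B → 2 ^ n < 2 ^ B := fun h => Nat.pow_lt_pow_right (by norm_num) h
  -- No intermediate value is reduced modulo `D`: the powers of `x` stay small enough.
  have hxi : ∀ i ≤ 2 * q, x ^ i ≤ 2 ^ (L * (2 * q)) := fun i hi => by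
    calc x ^ i ≤ (2 ^ L) ^ i := Nat.pow_le_pow_left hL.le i
      _ = 2 ^ (L * i) := (pow_mul _ _ _).symm
      _ ≤ _ := Nat.pow_le_pow_right (by norm_num) (Nat.mul_le_mul_left _ hi)
  have hxB : ∀ i ≤ 2 * q, x ^ i < 2 ^ B := fun i hi =>
    (hxi i hi).trans_lt (hpow (by omega))
  have hacc : ∀ i ≤ 2 * q, acc i < 2 ^ B := by
    intro i hi
    calc acc i ≤ ∑ j ∈ Finset.range i, D * 2 ^ (L * (2 * q)) :=
          Finset.sum_le_sum fun j hj => Nat.mul_le_mul (Nat.mod_lt _ (by positivity)).le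
            (hxi j (by have := Finset.mem_range.1 hj; omega))
      _ = i * 2 ^ (T + M + L * (2 * q)) := by simp [hD, pow_add]
      _ ≤ 2 ^ (2 * q) * 2 ^ (T + M + L * (2 * q)) :=
          Nat.mul_le_mul_right _ (Nat.lt_two_pow_self.le.trans
            (Nat.pow_le_pow_right (by norm_num) hi))
      _ = 2 ^ (2 * q + (T + M + L * (2 * q))) := (pow_add _ _ _).symm
      _ < 2 ^ B := hpow (by omega)
  have hx1 : x < 2 ^ B := hL.trans (hpow (by omega))
  have hsB : ∀ i, s / D ^ i < 2 ^ B := fun i => (Nat.div_le_self _ _).trans_lt (h 23)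
  have hb1 := h.update (v := 33) hx1
  have hf : ∀ i ≤ 2 * q, Store.Bounded B (f i) := fun i hi =>
    (((hb1.update (hacc i hi)).update (hxB i hi)).update (hsB i))
  have h1 := runs_assign hB h 33 (.add (.mul (.var 10) (.var 20)) (.var 11)) (K := 100) (n := x)
    (by simp [Expr.eval, hm, hx]) (by decide)
  have h2 := runs_assign hB hb1 30 (.lit 0) (K := 100) (n := 0) rfl (by decide)
  have hb2 := hb1.update (v := 30) (n := 0) (by positivity)
  have h3 := runs_assign hB hb2 31 (.lit 1) (K := 100) (n := 1) rfl (by decide)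
  have hb3 := hb2.update (v := 31) (n := 1) (one_lt_two_pow_of_one_le hB)
  have h4 := runs_assign hB hb3 32 (.var 23) (K := 100) (n := s) rfl (by decide)
  have h5 := runs_loop hB (.mul (.lit 2) (.var 5)) (seq (assign 30 (.add (.var 30)
      (.mul (.mod (.var 32) (.mul (.var 21) (.var 22))) (.var 31)))) <|
    seq (assign 31 (.mul (.var 31) (.var 33)))
      (assign 32 (.div (.var 32) (.mul (.var 21) (.var 22))))) (K := 100) (n := 2 * q)
      (τ := 100 * B ^ 2 + (100 * B ^ 2 + 100 * B ^ 2)) f (hf 0 (by omega))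
      (by simp [Expr.eval, f, hq]) (by decide) (by
        intro i hi
        have e1 : acc (i + 1) = acc i + s / D ^ i % D * x ^ i := Finset.sum_range_succ _ _
        have g1 := runs_assign hB (hf i (by omega)) 30 (.add (.var 30)
          (.mul (.mod (.var 32) (.mul (.var 21) (.var 22))) (.var 31))) (K := 100)
          (n := acc (i + 1)) (by simp [Expr.eval, f, hT, hM, ← pow_add, e1, hD]) (by decide)
        have b1 := (hf i (by omega)).update (v := 30) (hacc (i + 1) (by omega))
        have g2 := runs_assign hB b1 31 (.mul (.var 31) (.var 33)) (K := 100)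
          (n := x ^ (i + 1)) (by simp [Expr.eval, f, pow_succ]) (by decide)
        have b2 := b1.update (v := 31) (hxB (i + 1) (by omega))
        have g3 := runs_assign hB b2 32 (.div (.var 32) (.mul (.var 21) (.var 22))) (K := 100)
          (n := s / D ^ (i + 1))
          (by simp [Expr.eval, f, hT, hM, ← pow_add, hD, pow_succ, Nat.div_div_eq_div_mul])
          (by decide)
        convert g1.seq (g2.seq g3) using 1
        funext v
        simp only [f, Function.update_apply]
        split_ifs <;> rfl)
  have hf0 : f 0 = Function.update (Function.update (Function.update
    (Function.update σ 33 x) 30 0) 31 1) 32 s := by simp [f, acc]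
  rw [hf0] at h5
  set r := hashNat T M (2 * q) s x % σ 4 with hr
  have hrB : r < 2 ^ B := ((Nat.mod_le _ _).trans_lt (hashNat_lt _ _ _ _ _)).trans
    (hpow (by omega))
  have h6 := runs_assign hB (hf (2 * q) le_rfl) 15
    (.mod (.mod (.div (.var 30) (.var 21)) (.var 22)) (.var 4)) (K := 100) (n := r)
    (by simp [Expr.eval, f, hT, hM, hr, hashNat, acc, hD]) (by decide)
  set σ₁ := Function.update (f (2 * q)) 15 r with hσ₁
  have b1 : Store.Bounded B σ₁ := (hf (2 * q) le_rfl).update hrB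
  have hfr : ∀ v < 30, v ≠ 15 → σ₁ v = σ v := by
    intro v hv hv'
    simp only [σ₁, f, Function.update_apply]
    rw [if_neg hv', if_neg (by omega), if_neg (by omega), if_neg (by omega), if_neg (by omega)]
  have h1B : 1 ≤ 100 * B ^ 2 := Nat.mul_pos (by norm_num) (by positivity)
  have h7 := runs_ite hB b1 (.add (.add (.sub (.var 10) (.var 6)) (.sub (.var 6) (.var 10)))
          (.add (.sub (.var 11) (.var 7)) (.sub (.var 7) (.var 11))))
        skip (assign 15 (.var 8)) (K := 100) (τ := 100 * B ^ 2)
        (σ' := if σ 10 = σ 6 ∧ σ 11 = σ 7 then Function.update σ₁ 15 (σ 8) else σ₁) (by decide)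
        (by
          intro h0
          simp [Expr.eval, hfr] at h0
          rw [if_neg (by omega)]
          exact runs_skip h1B)
        (by
          intro h0
          simp [Expr.eval, hfr] at h0
          rw [if_pos (by omega)]
          exact runs_assign hB b1 15 (.var 8) (hfr 8 (by omega) (by omega)) (by decide))
  have h8 := runs_ite hB b1 (.var 26) _ skip (K := 100) (τ := 100 * B ^ 2 + 100 * B ^ 2)
    (σ' := if σ 26 ≠ 0 ∧ σ 10 = σ 6 ∧ σ 11 = σ 7 then Function.update σ₁ 15 (σ 8) else σ₁)
    (by decide)
    (by
      intro h0
      simp only [Expr.eval, hfr 26 (by omega) (by omega)] at h0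
      simp only [h0, ne_eq, not_false_eq_true, true_and]
      exact h7)
    (by
      intro h0
      simp only [Expr.eval, hfr 26 (by omega) (by omega)] at h0
      simp only [h0, ne_eq, not_true_eq_false, false_and, if_false]
      exact runs_skip (by omega))
  refine ⟨_, (h1.seq (h2.seq (h3.seq (h4.seq (h5.seq (h6.seq h8)))))).mono ?_, ?_⟩
  · nlinarith
  · split <;> simp [σ₁]

end Code

/-! ### Branches of quantum programs -/

section spec

variable {P : SigmaProtocol} {q w : ℕ} {E : Type*} [NormedAddCommGroup E] [InnerProductSpace ℂ E]

/-- Store and state of a branch. -/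
def Config.erase (g : Config P w E) : Store × (Mem P w → E) := (g.store, g.state)

/-- Started with store `σ` and state `ψ`, the program `p` has the list of branches `l`, and each of
them takes at most `τ` steps. -/
def Prog.Spec (A : FSAdversary P q E) (p : Prog) (σ : Store) (ψ : Mem P w → E)
    (l : List (Store × (Mem P w → E))) (τ : ℕ) : Prop :=
  ∀ t, (p.exec A ⟨σ, ψ, t⟩).map Config.erase = l ∧ ∀ g ∈ p.exec A ⟨σ, ψ, t⟩, g.time ≤ t + τ

namespace Prog

variable {A : FSAdversary P q E} {σ σ' : Store} {ψ ψ' : Mem P w → E}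

theorem Spec.mono {p : Prog} {l : List (Store × (Mem P w → E))} {τ τ' : ℕ}
    (h : p.Spec A σ ψ l τ) (hτ : τ ≤ τ') : p.Spec A σ ψ l τ' :=
  fun t => ⟨(h t).1, fun g hg => ((h t).2 g hg).trans (by omega)⟩

/-- Composition, with the branches of the first program indexed by a list `L`. -/
theorem Spec.seq {ι : Type*} {p₁ p₂ : Prog} {L : List ι} {g : ι → Store × (Mem P w → E)}
    {l : ι → List (Store × (Mem P w → E))} {τ₁ τ₂ : ℕ} (h₁ : p₁.Spec A σ ψ (L.map g) τ₁)
    (h₂ : ∀ i ∈ L, p₂.Spec A (g i).1 (g i).2 (l i) τ₂) :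
    (Prog.seq p₁ p₂).Spec A σ ψ (L.flatMap l) (τ₁ + τ₂) := by
  intro t
  obtain ⟨h3, h4⟩ := h₁ t
  simp only [exec]
  generalize p₁.exec A ⟨σ, ψ, t⟩ = xs at h3 h4
  clear h₁
  induction L generalizing xs with
  | nil =>
    obtain rfl : xs = [] := by simpa using h3
    simp
  | cons i L ih =>
    rcases xs with _ | ⟨x, xs⟩
    · simp at h3
    simp only [List.map_cons, List.cons.injEq] at h3
    obtain ⟨h5, h6⟩ := h3
    obtain ⟨h7, h8⟩ := ih (fun j hj => h₂ j (List.mem_cons_of_mem _ hj)) xs h6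
      (fun g hg => h4 g (List.mem_cons_of_mem _ hg))
    obtain ⟨h9, h10⟩ := h₂ i (by simp) x.time
    have hx : (⟨(g i).1, (g i).2, x.time⟩ : Config P w E) = x := by rw [← h5]; rfl
    rw [hx] at h9 h10
    have hxt := h4 x (by simp)
    refine ⟨by simp only [List.flatMap_cons, List.map_append, h7, h9], fun g' hg' => ?_⟩
    rw [List.flatMap_cons, List.mem_append] at hg'
    rcases hg' with hg' | hg'
    · exact (h10 g' hg').trans (by omega)
    · exact h8 g' hg'

theorem Spec.seq_det {p₁ p₂ : Prog} {l : List (Store × (Mem P w → E))} {τ₁ τ₂ : ℕ}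
    (h₁ : p₁.Spec A σ ψ [(σ', ψ')] τ₁) (h₂ : p₂.Spec A σ' ψ' l τ₂) :
    (Prog.seq p₁ p₂).Spec A σ ψ l (τ₁ + τ₂) := by
  have := Spec.seq (L := [()]) (g := fun _ => (σ', ψ')) (l := fun _ => l) h₁ (fun _ _ => h₂)
  simpa using this

theorem spec_classical {c : Code} {τ : ℕ} (h : c.Runs σ σ' τ) :
    (classical c).Spec A σ ψ [(σ', ψ)] τ := by
  intro t
  obtain ⟨h1, h2⟩ := h t
  simp only [exec, List.map_cons, List.map_nil, Config.erase, h1, List.mem_singleton,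
    forall_eq, h2, and_self]

theorem spec_loop {B : ℕ} (hB : 1 ≤ B) (e : Expr) (p : Prog) {K τ n : ℕ}
    (f : ℕ → Store) (φ : ℕ → Mem P w → E) (h : Store.Bounded B (f 0)) (hn : e.eval (f 0) = n)
    (hK : e.costFactor + 1 ≤ K) (hc : ∀ i < n, p.Spec A (f i) (φ i) [(f (i + 1), φ (i + 1))] τ) :
    (loop e p).Spec A (f 0) (φ 0) [(f n, φ n)] (K * B ^ 2 + n * (τ + 1)) := by
  have h1 := Expr.cost_le hB h e
  have h2 : (e.costFactor + 1) * B ^ 2 ≤ K * B ^ 2 := Nat.mul_le_mul_right _ hK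
  have h3 : 1 ≤ B ^ 2 := Nat.one_le_pow _ _ hB
  rw [add_mul] at h2
  intro t
  simp only [exec, hn]
  have key : ∀ i ≤ n, ∃ t' ≤ t + e.cost (f 0) + 1 + i * (τ + 1),
      (fun l : List (Config P w E) => l.flatMap fun h => p.exec A (h.tick 1))^[i]
        [(⟨f 0, φ 0, t⟩ : Config P w E).tick (e.cost (f 0) + 1)] = [⟨f i, φ i, t'⟩] := by
    intro i hi
    induction i with
    | zero => exact ⟨_, by simp [add_assoc], rfl⟩
    | succ i ih =>
      obtain ⟨t', ht', h4⟩ := ih (by omega)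
      rw [Function.iterate_succ_apply', h4]
      obtain ⟨h5, h6⟩ := hc i (by omega) (t' + 1)
      simp only [List.flatMap_cons, List.flatMap_nil, List.append_nil, Config.tick]
      obtain ⟨x, hx, hxe⟩ := List.map_eq_singleton_iff.1 h5
      rw [hx] at h6 ⊢
      have h7 := h6 x (by simp)
      refine ⟨x.time, ?_, ?_⟩
      · rw [add_mul i 1]; omega
      · simp only [Config.erase, Prod.mk.injEq] at hxe
        rw [← hxe.1, ← hxe.2]
  obtain ⟨t', ht', h4⟩ := key n le_rfl
  rw [h4]
  refine ⟨rfl, ?_⟩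
  simp only [List.mem_singleton, forall_eq]
  omega

theorem spec_toss {B : ℕ} (hB : 1 ≤ B) (h : Store.Bounded B σ) (e : Expr) (v : ℕ) {K n : ℕ}
    (hn : e.eval σ = n) (hK : e.costFactor + 1 ≤ K) :
    (toss e v).Spec A σ ψ ((List.range (2 ^ n)).map fun m =>
      (Function.update σ v m, fun b => (((1 / Real.sqrt 2) ^ n : ℝ) : ℂ) • ψ b))
      (K * B ^ 2 + n) := by
  have h1 := Expr.cost_le hB h e
  have h2 : (e.costFactor + 1) * B ^ 2 ≤ K * B ^ 2 := Nat.mul_le_mul_right _ hK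
  have h3 : 1 ≤ B ^ 2 := Nat.one_le_pow _ _ hB
  rw [add_mul] at h2
  intro t
  subst hn
  simp only [exec, List.map_map]
  refine ⟨rfl, fun g hg => ?_⟩
  obtain ⟨m, -, rfl⟩ := List.mem_map.1 hg
  simp only
  omega

theorem spec_measure {B : ℕ} (hB : 1 ≤ B) (h : Store.Bounded B σ) (r : Reg) (e : Expr) (v : ℕ)
    {K n : ℕ} (hn : e.eval σ = n) (hK : e.costFactor + 2 ≤ K) :
    (measure r (.lit 0) e v).Spec A σ ψ ((List.range (2 ^ n)).map fun m =>
      (Function.update σ v m, measOp r 0 n m ψ)) (K * B ^ 2 + n) := by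
  have h1 := Expr.cost_le hB h e
  have h2 : (e.costFactor + 2) * B ^ 2 ≤ K * B ^ 2 := Nat.mul_le_mul_right _ hK
  have h3 : 1 ≤ B ^ 2 := Nat.one_le_pow _ _ hB
  rw [add_mul] at h2
  intro t
  subst hn
  simp only [exec, List.map_map]
  refine ⟨rfl, fun g hg => ?_⟩
  obtain ⟨m, -, rfl⟩ := List.mem_map.1 hg
  have : Expr.cost σ (.lit 0) = 1 := by simp [Expr.cost]
  simp only [this]
  omega

theorem spec_call {B : ℕ} (hB : 1 ≤ B) (h : Store.Bounded B σ) (e : Expr)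
    {K : ℕ} (hK : e.costFactor + 1 ≤ K) :
    (call e).Spec A σ ψ [(σ, callOp A (e.eval σ) ψ)] (K * B ^ 2) := by
  have h1 := Expr.cost_le hB h e
  have h2 : (e.costFactor + 1) * B ^ 2 ≤ K * B ^ 2 := Nat.mul_le_mul_right _ hK
  have h3 : 1 ≤ B ^ 2 := Nat.one_le_pow _ _ hB
  rw [add_mul] at h2
  intro t
  refine ⟨rfl, ?_⟩
  simp only [exec, List.mem_singleton, forall_eq]
  omega

theorem spec_apply (t : Reg) (f : Code) {τ : ℕ} (h : ∀ b : Mem P w, (codeOn t f σ b).2 ≤ τ) :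
    (apply t f).Spec A σ ψ [(σ, applyOp t f σ ψ)]
      (P.instLen + P.comLen + P.chalLen + P.respLen + w + τ + 1) := by
  intro t'
  refine ⟨rfl, ?_⟩
  have : Finset.univ.sup (fun b : Mem P w => (codeOn t f σ b).2) ≤ τ :=
    Finset.sup_le fun b _ => h b
  simp only [exec, List.mem_singleton, forall_eq, applyCost]
  omega

end Prog

/-! ### States of the adversary as states of the machine -/

/-- The state of the machine with state `φ` of the adversary's registers, and with work qubits in
state `0`. -/
def embed (w : ℕ) (φ : AdvSpace P E) : Mem P w → E := fun b => if b.2 = 0#_ then φ b.1 else 0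

theorem embed_smul (a : ℂ) (φ : AdvSpace P E) :
    embed w (a • φ) = fun b => a • embed w φ b := by
  funext b
  simp only [embed]
  split <;> simp

theorem applyOp_embed {f : Code} {σ : Store} {H : P.Oracle}
    (h : ∀ b : Mem P w, (codeOn Reg.chal f σ b).1 15 = (H (b.1.1, b.1.2.1)).val)
    (φ : AdvSpace P E) : applyOp Reg.chal f σ (embed w φ) = embed w (queryOp H φ) := by
  funext b
  simp only [applyOp, h]
  rfl

theorem callOp_embed (A : FSAdversary P q E) (j : ℕ) (φ : AdvSpace P E) :
    callOp A j (embed w φ) = embed w (A.applyU j φ) := by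
  funext b
  simp only [callOp, embed]
  split
  · rfl
  · have h0 : A.applyU j (0 : AdvSpace P E) = 0 := by
      unfold FSAdversary.applyU
      split
      · exact map_zero _
      · rfl
    have h1 : (WithLp.toLp 2 fun _ => (0 : E) : AdvSpace P E) = 0 := rfl
    rw [h1, h0]
    rfl

theorem measOp_measOp_embed {x a : ℕ} (hx : x < 2 ^ P.instLen) (ha : a < 2 ^ P.comLen)
    (φ : AdvSpace P E) :
    measOp Reg.com 0 P.comLen a (measOp Reg.inst 0 P.instLen x (embed w φ)) =
      embed w (projX (BitVec.ofNat _ x, BitVec.ofNat _ a) φ) := by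
  funext b
  have h1 : b.1.1.toNat = x ↔ b.1.1 = BitVec.ofNat _ x := by
    rw [← BitVec.toNat_inj, BitVec.toNat_ofNat, Nat.mod_eq_of_lt hx]
  have h2 : b.1.2.1.toNat = a ↔ b.1.2.1 = BitVec.ofNat _ a := by
    rw [← BitVec.toNat_inj, BitVec.toNat_ofNat, Nat.mod_eq_of_lt ha]
  simp only [measOp, embed, Mem.get, pow_zero, Nat.div_one, projX_apply, Prod.mk.injEq,
    Nat.mod_eq_of_lt (BitVec.isLt _), h1, h2]
  split_ifs <;> simp_all

/-- The probability to find a certain response in the register `Z`. -/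
theorem sum_measOp_resp_embed (φ : AdvSpace P E) (p : BitVec P.respLen → Prop) [DecidablePred p] :
    ∑ z ∈ Finset.range (2 ^ P.respLen), (if p (BitVec.ofNat _ z) then
      ∑ b : Mem P w, ‖measOp Reg.resp 0 P.respLen z (embed w φ) b‖ ^ 2 else 0) =
    ∑ b : Basis P, if p b.2.2.2 then ‖φ b‖ ^ 2 else 0 := by
  have h1 : ∀ z, ∑ b : Mem P w, ‖measOp Reg.resp 0 P.respLen z (embed w φ) b‖ ^ 2 =
      ∑ b : Basis P, if b.2.2.2.toNat = z then ‖φ b‖ ^ 2 else 0 := by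
    intro z
    rw [Fintype.sum_prod_type]
    refine Finset.sum_congr rfl fun b _ => ?_
    rw [Finset.sum_eq_single 0#w]
    · simp only [measOp, embed, Mem.get, pow_zero, Nat.div_one,
        Nat.mod_eq_of_lt (BitVec.isLt _), if_true]
      split <;> simp
    · intro y _ hy
      simp [measOp, embed, hy]
    · simp
  simp only [h1]
  have h2 : ∀ z, (if p (BitVec.ofNat _ z) then
      ∑ b : Basis P, (if b.2.2.2.toNat = z then ‖φ b‖ ^ 2 else 0) else 0) =
      ∑ b : Basis P, if b.2.2.2.toNat = z then (if p b.2.2.2 then ‖φ b‖ ^ 2 else 0) else 0 := by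
    intro z
    split
    · rename_i hp
      refine Finset.sum_congr rfl fun b _ => ?_
      by_cases h : b.2.2.2.toNat = z
      · subst h
        rw [BitVec.ofNat_toNat, BitVec.setWidth_eq] at hp
        simp [hp]
      · simp [h]
    · rename_i hp
      refine (Finset.sum_eq_zero fun b _ => ?_).symm
      by_cases h : b.2.2.2.toNat = z
      · subst h
        rw [BitVec.ofNat_toNat, BitVec.setWidth_eq] at hp
        simp [hp]
      · simp [h]
  simp only [h2]
  rw [Finset.sum_comm]
  refine Finset.sum_congr rfl fun b _ => ?_
  rw [Finset.sum_ite_eq, if_pos (Finset.mem_range.2 b.2.2.2.isLt)]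

end spec

/-! ### The two stages of the reduction -/

/-- A bound on the bit length of all numbers that occur in the reduction. -/
def bits (P : SigmaProtocol) (q : ℕ) : ℕ := 8 * (sizeParam P q + 1) ^ 3

/-- The expression for `lowLen P q`. -/
def lowLenExpr : Expr := .mul (.add (.var 0) (.var 1)) (.mul (.lit 2) (.var 5))

/-- The expression for `highLen P`. -/
def highLenExpr : Expr := .add (.add (.add (.var 0) (.var 1)) (.var 2)) (.lit 1)

/-- One step of the adversary, with the query answered by `Code.oracle` and the index of the unitary in
variable `25`. -/
def stepProg : Prog :=
  .seq (.apply Reg.chal Code.oracle) <|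
  .seq (.call (.var 25)) (.classical (.assign 25 (.add (.var 25) (.lit 1))))

/-- The first stage: draw a seed and a random number `m ≤ 2 * q`, run the adversary for `m / 2`
steps, and measure the instance and the first message. -/
def firstProg : Prog :=
  .seq (.classical (.seq (Code.pow2 20 (.var 1))
    (.seq (Code.pow2 21 lowLenExpr) (Code.pow2 22 highLenExpr)))) <|
  .seq (.toss (.mul (.add lowLenExpr highLenExpr) (.mul (.lit 2) (.var 5))) 23) <|
  .seq (.toss (.add (.mul (.lit 2) (.var 5)) (.lit 1)) 24) <|
  .seq (.classical (.assign 24 (.mod (.var 24) (.add (.mul (.lit 2) (.var 5)) (.lit 1))))) <|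
  .seq (.loop (.div (.var 24) (.lit 2)) stepProg) <|
  .seq (.measure Reg.inst (.lit 0) (.var 0) 6) (.measure Reg.com (.lit 0) (.var 1) 7)

/-- The second stage: run the adversary to its end, with the oracle reprogrammed from the first or
second query on, according to the parity of `m`, and measure the response. -/
def secondProg : Prog :=
  .seq (.classical (.assign 26 (.mod (.var 24) (.lit 2)))) <|
  .seq (.loop (.sub (.var 5) (.var 25))
    (.seq stepProg (.classical (.assign 26 (.lit 1))))) <|
  .measure Reg.resp (.lit 0) (.var 3) 9

/-- The measure-and-reprogram reduction; it needs no work qubits. -/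
def reduction : TwoStage := ⟨firstProg, secondProg, 0⟩

section programs

variable {P : SigmaProtocol} {q w : ℕ} {E : Type*} [NormedAddCommGroup E] [InnerProductSpace ℂ E]

theorem one_le_bits : 1 ≤ bits P q := by
  have : 0 < 8 * (sizeParam P q + 1) ^ 3 := by positivity
  exact this

theorem sizeParam_lt_bits : sizeParam P q < bits P q := by
  unfold bits
  generalize sizeParam P q = n
  nlinarith [Nat.zero_le (n ^ 3), Nat.zero_le (n ^ 2)]

theorem lowLen_add_lt_bits :
    (P.instLen + P.comLen) * (2 * q) + (lowLen P q + highLen P) + 2 * q +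
      (P.instLen + P.comLen) < bits P q := by
  have hn : sizeParam P q = P.instLen + P.comLen + P.chalLen + P.respLen + q := rfl
  unfold bits lowLen highLen
  generalize sizeParam P q = n at hn
  have h1 : (P.instLen + P.comLen) * (2 * q) ≤ n * (2 * n) :=
    Nat.mul_le_mul (by omega) (by omega)
  have h2 : P.instLen + P.comLen + P.chalLen ≤ n := by omega
  have h3 : q ≤ n := by omega
  nlinarith [Nat.zero_le (n ^ 3), Nat.zero_le (n ^ 2)]

theorem seedLen_lt_bits : seedLen P q < bits P q := by
  have hn : sizeParam P q = P.instLen + P.comLen + P.chalLen + P.respLen + q := rfl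
  unfold bits seedLen lowLen highLen
  generalize sizeParam P q = n at hn
  have h1 : (P.instLen + P.comLen) * (2 * q) ≤ n * (2 * n) :=
    Nat.mul_le_mul (by omega) (by omega)
  have h4 : ((P.instLen + P.comLen) * (2 * q) + (P.instLen + P.comLen + P.chalLen + 1)) * (2 * q)
      ≤ (n * (2 * n) + (n + 1)) * (2 * n) := Nat.mul_le_mul (by omega) (by omega)
  nlinarith [Nat.zero_le (n ^ 3), Nat.zero_le (n ^ 2)]

/-- The variables that the two stages set up and do not change have their intended values, with seed
`s`, and all variables are bounded. -/
structure Ready (P : SigmaProtocol) (q s : ℕ) (σ : Store) : Prop where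
  inst : σ 0 = P.instLen
  com : σ 1 = P.comLen
  resp : σ 3 = P.respLen
  card : σ 4 = P.chalCard
  queries : σ 5 = q
  comPow : σ 20 = 2 ^ P.comLen
  lowPow : σ 21 = 2 ^ lowLen P q
  highPow : σ 22 = 2 ^ highLen P
  seed : σ 23 = s
  bounded : Store.Bounded (bits P q) σ

theorem Ready.update {s : ℕ} {σ : Store} (h : Ready P q s σ) {v n : ℕ}
    (hv : v ∈ [6, 7, 8, 9, 24, 25, 26]) (hn : n < 2 ^ bits P q) :
    Ready P q s (Function.update σ v n) := by
  have hu : ∀ u, u ∉ [6, 7, 8, 9, 24, 25, 26] → Function.update σ v n u = σ u := fun u hu =>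
    Function.update_of_ne (fun e => hu (by rw [e]; exact hv)) _ _
  exact ⟨by rw [hu _ (by decide), h.inst], by rw [hu _ (by decide), h.com],
    by rw [hu _ (by decide), h.resp], by rw [hu _ (by decide), h.card],
    by rw [hu _ (by decide), h.queries], by rw [hu _ (by decide), h.comPow],
    by rw [hu _ (by decide), h.lowPow], by rw [hu _ (by decide), h.highPow],
    by rw [hu _ (by decide), h.seed], h.bounded.update hn⟩

theorem lt_two_pow_bits {n : ℕ} (h : n ≤ bits P q) : n < 2 ^ bits P q :=
  h.trans_lt Nat.lt_two_pow_self

theorem two_pow_lt_two_pow_bits {n : ℕ} (h : n < bits P q) : 2 ^ n < 2 ^ bits P q :=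
  Nat.pow_lt_pow_right (by norm_num) h

/-- The oracle that `Code.oracle` computes: it is reprogrammed if the flag is set. -/
def storeOracle (P : SigmaProtocol) (q s : ℕ) (σ : Store) (c : P.Chal) : P.Oracle :=
  if σ 26 = 0 then hashOracle P q s else
    Function.update (hashOracle P q s) (BitVec.ofNat _ (σ 6), BitVec.ofNat _ (σ 7)) c

theorem Ready.codeOn_oracle {s : ℕ} {σ : Store} (h : Ready P q s σ) (hw : w < bits P q)
    {c : P.Chal} (hflag : σ 26 ≠ 0 → σ 6 < 2 ^ P.instLen ∧ σ 7 < 2 ^ P.comLen ∧ σ 8 = c.val)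
    (b : Mem P w) :
    (codeOn Reg.chal Code.oracle σ b).1 15 = (storeOracle P q s σ c (b.1.1, b.1.2.1)).val ∧
      (codeOn Reg.chal Code.oracle σ b).2 ≤ (2 * q + 1) * (1000 * bits P q ^ 2) := by
  have hsz := sizeParam_lt_bits (P := P) (q := q)
  unfold sizeParam at hsz
  have hb : Store.Bounded (bits P q) (b.load Reg.chal σ) := by
    intro v
    simp only [Mem.load, Mem.get, reduceCtorEq, if_false, if_true]
    split_ifs
    · exact b.1.1.isLt.trans (two_pow_lt_two_pow_bits (by omega))
    · exact b.1.2.1.isLt.trans (two_pow_lt_two_pow_bits (by omega))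
    -- The target register is hidden from the program, which finds `0` in its place.
    · positivity
    · exact b.1.2.2.2.isLt.trans (two_pow_lt_two_pow_bits (by omega))
    · exact b.2.isLt.trans (two_pow_lt_two_pow_bits hw)
    · exact h.bounded v
  have h10 : b.load Reg.chal σ 10 = b.1.1.toNat := rfl
  have h11 : b.load Reg.chal σ 11 = b.1.2.1.toNat := rfl
  have henc := encX_lt P (b.1.1, b.1.2.1)
  obtain ⟨σ', h1, h2⟩ := Code.runs_oracle hb (q := q) (m := P.comLen) (L := P.instLen + P.comLen)
    (T := lowLen P q) (M := highLen P) h.queries h.comPow h.lowPow h.highPow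
    (by rw [h10, h11]; exact henc) lowLen_add_lt_bits
  obtain ⟨h3, h4⟩ := h1 0
  rw [zero_add] at h4
  refine ⟨?_, h4⟩
  have h5 : (codeOn Reg.chal Code.oracle σ b).1 15 = σ' 15 := congrFun h3 15
  rw [h5, h2, h10, h11]
  have e26 : b.load Reg.chal σ 26 = σ 26 := rfl
  have e6 : b.load Reg.chal σ 6 = σ 6 := rfl
  have e7 : b.load Reg.chal σ 7 = σ 7 := rfl
  have e8 : b.load Reg.chal σ 8 = σ 8 := rfl
  have e23 : b.load Reg.chal σ 23 = σ 23 := rfl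
  have e4 : b.load Reg.chal σ 4 = σ 4 := rfl
  rw [e26, e6, e7, e8, e23, e4, h.seed, h.card]
  unfold storeOracle
  by_cases h0 : σ 26 = 0
  · simp only [h0, ne_eq, not_true_eq_false, false_and, if_false, if_true]
    rfl
  · obtain ⟨hx, ha, hc⟩ := hflag h0
    have hx' : b.1.1.toNat = σ 6 ↔ b.1.1 = BitVec.ofNat _ (σ 6) := by
      rw [← BitVec.toNat_inj, BitVec.toNat_ofNat, Nat.mod_eq_of_lt hx]
    have ha' : b.1.2.1.toNat = σ 7 ↔ b.1.2.1 = BitVec.ofNat _ (σ 7) := by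
      rw [← BitVec.toNat_inj, BitVec.toNat_ofNat, Nat.mod_eq_of_lt ha]
    simp only [h0, ne_eq, not_false_eq_true, true_and, if_false, hx', ha', hc,
      Function.update_apply, Prod.mk.injEq]
    split <;> rfl

/-- One step of the machine is one step of the adversary, with the possibly reprogrammed oracle. The
conditions on the variables of the reprogrammed query are void as long as the flag is not set. -/
theorem Ready.spec_stepProg {s : ℕ} {σ : Store} (h : Ready P q s σ) (hw : w < bits P q)
    {c : P.Chal} (hflag : σ 26 ≠ 0 → σ 6 < 2 ^ P.instLen ∧ σ 7 < 2 ^ P.comLen ∧ σ 8 = c.val)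
    (A : FSAdversary P q E) (φ : AdvSpace P E) :
    stepProg.Spec A σ (embed w φ) [(Function.update σ 25 (σ 25 + 1),
      embed w (A.step (storeOracle P q s σ c) (σ 25) φ))] (4000 * bits P q ^ 3) := by
  have hB := one_le_bits (P := P) (q := q)
  have h1 := Prog.spec_apply (A := A) (σ := σ) (ψ := embed w φ) Reg.chal Code.oracle
    (fun b => (h.codeOn_oracle hw hflag b).2)
  rw [applyOp_embed (fun b => (h.codeOn_oracle hw hflag b).1)] at h1
  have h2 := Prog.spec_call (A := A) (ψ := embed w (queryOp (storeOracle P q s σ c) φ)) hB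
    h.bounded (.var 25) (K := 100) (by decide)
  rw [callOp_embed] at h2
  have h3 := Prog.spec_classical (A := A)
    (ψ := embed w (A.applyU (σ 25) (queryOp (storeOracle P q s σ c) φ)))
    (Code.runs_assign hB h.bounded 25 (.add (.var 25) (.lit 1)) (K := 100) (n := σ 25 + 1)
      rfl (by decide))
  rw [A.step_apply]
  refine (h1.seq_det (h2.seq_det h3)).mono ?_
  have hsz := sizeParam_lt_bits (P := P) (q := q)
  unfold sizeParam at hsz
  generalize bits P q = B at *
  have hq : 2 * q + 1 ≤ 2 * B := by omega
  have h4 : (2 * q + 1) * (1000 * B ^ 2) ≤ 2 * B * (1000 * B ^ 2) := Nat.mul_le_mul_right _ hq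
  have h5 : 2 * B * (1000 * B ^ 2) = 2000 * B ^ 3 := by ring
  have h6 : B ^ 2 ≤ B ^ 3 := Nat.pow_le_pow_right hB (by norm_num)
  have h7 : B ≤ B ^ 2 := by nlinarith
  omega

theorem FSAdversary.evolve_succ' (A : FSAdversary P q E) (H : P.Oracle) (j r : ℕ)
    (φ : AdvSpace P E) : A.evolve H j (r + 1) φ = A.step H (j + r) (A.evolve H j r φ) := by
  induction r generalizing j φ with
  | zero => rfl
  | succ r ih => rw [evolve_succ, ih, evolve_succ, Nat.add_right_comm, add_assoc]

theorem FSAdversary.resume_succ (A : FSAdversary P q E) (H H' : P.Oracle) (flag : Bool) (j r : ℕ)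
    (φ : AdvSpace P E) : A.resume H H' flag j (r + 1) φ =
      A.step (if flag = true ∨ r ≠ 0 then H' else H) (j + r) (A.resume H H' flag j r φ) := by
  cases r with
  | zero => simp [resume, evolve]
  | succ r =>
    simp only [resume, LinearMap.comp_apply, evolve_succ', ne_eq, Nat.add_eq_zero_iff, one_ne_zero,
      and_false, not_false_eq_true, or_true, if_true]
    rw [Nat.add_right_comm, add_assoc]

theorem pow_le_bits {a b : ℕ} (h : a ≤ b) : bits P q ^ a ≤ bits P q ^ b :=
  Nat.pow_le_pow_right one_le_bits h

theorem Ready.spec_secondProg {s : ℕ} {σ : Store} (h : Ready P q s σ) (hw : w < bits P q)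
    {c : P.Chal} (hx : σ 6 < 2 ^ P.instLen) (ha : σ 7 < 2 ^ P.comLen) (hc : σ 8 = c.val)
    (hm : σ 24 ≤ 2 * q) (hj : σ 25 = σ 24 / 2) (A : FSAdversary P q E) (φ : AdvSpace P E) :
    ∃ σ', secondProg.Spec A σ (embed w φ) ((List.range (2 ^ P.respLen)).map fun z =>
      (Function.update σ' 9 z, measOp Reg.resp 0 P.respLen z (embed w
        (A.resume (hashOracle P q s) (Function.update (hashOracle P q s)
          (BitVec.ofNat _ (σ 6), BitVec.ofNat _ (σ 7)) c) (decide (σ 24 % 2 = 1)) (σ 24 / 2)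
          (q - σ 24 / 2) φ)))) (5000 * bits P q ^ 4) := by
  have hB := one_le_bits (P := P) (q := q)
  have hsz := sizeParam_lt_bits (P := P) (q := q)
  unfold sizeParam at hsz
  set H := hashOracle P q s with hH
  set H' := Function.update H (BitVec.ofNat _ (σ 6), BitVec.ofNat _ (σ 7)) c with hH'
  set m := σ 24 with hm_def
  -- The store after `i` rounds of the loop: only the first round uses the parity of `m` as its flag.
  let f : ℕ → Store := fun i => Function.update
    (Function.update σ 26 (if i = 0 then m % 2 else 1)) 25 (m / 2 + i)
  have hfr : ∀ i ≤ q - m / 2, Ready P q s (f i) := fun i hi =>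
    (h.update (by decide) (lt_two_pow_bits (by split <;> omega))).update (by decide)
      (lt_two_pow_bits (by omega))
  have h1 := Prog.spec_classical (A := A) (ψ := embed w φ)
    (Code.runs_assign hB h.bounded 26 (.mod (.var 24) (.lit 2)) (K := 100) (n := m % 2)
      rfl (by decide))
  have hf0 : f 0 = Function.update σ 26 (m % 2) := by
    funext v
    simp only [f, if_true, add_zero, ← hj]
    by_cases hv : v = 25
    · subst hv; simp
    · rw [Function.update_of_ne hv]
  rw [← hf0] at h1
  have h2 := Prog.spec_loop (A := A) hB (.sub (.var 5) (.var 25))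
    (.seq stepProg (.classical (.assign 26 (.lit 1)))) (K := 100) (n := q - m / 2)
    (τ := 4000 * bits P q ^ 3 + 100 * bits P q ^ 2)
    f (fun i => embed w (A.resume H H' (decide (m % 2 = 1)) (m / 2) i φ)) (hfr 0 (by omega)).bounded
    (by simp [Expr.eval, f, h.queries]) (by decide) (by
      intro i hi
      have g0 := hfr i hi.le
      have f6 : f i 6 = σ 6 := by simp [f]
      have f7 : f i 7 = σ 7 := by simp [f]
      have f8 : f i 8 = c.val := by simp [f, hc]
      have f25 : f i 25 = m / 2 + i := by simp [f]
      have f26 : f i 26 = if i = 0 then m % 2 else 1 := by simp [f]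
      have g1 := g0.spec_stepProg hw (c := c)
        (fun _ => ⟨by rw [f6]; exact hx, by rw [f7]; exact ha, f8⟩) A
        (A.resume H H' (decide (m % 2 = 1)) (m / 2) i φ)
      have hO : storeOracle P q s (f i) c =
          if decide (m % 2 = 1) = true ∨ i ≠ 0 then H' else H := by
        unfold storeOracle
        rw [f26, f6, f7]
        by_cases hi0 : i = 0
        · rcases Nat.mod_two_eq_zero_or_one m with h0 | h0 <;> simp [hi0, h0, hH, hH']
        · simp [hi0, hH', hH]
      rw [hO, f25, ← A.resume_succ] at g1
      have hb := g0.bounded.update (v := 25) (n := m / 2 + i + 1) (lt_two_pow_bits (by omega))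
      have g2 := Prog.spec_classical (A := A)
        (ψ := embed w (A.resume H H' (decide (m % 2 = 1)) (m / 2) (i + 1) φ))
        (Code.runs_assign hB hb 26 (.lit 1) (K := 100) (n := 1) rfl (by decide))
      convert g1.seq_det g2 using 3
      funext v
      simp only [f, Function.update_apply]
      split_ifs <;> first | rfl | contradiction | omega)
  have h3 := Prog.spec_measure (A := A) (ψ := embed w (A.resume H H' (decide (m % 2 = 1)) (m / 2)
    (q - m / 2) φ)) hB (hfr (q - m / 2) le_rfl).bounded Reg.resp (.var 3) 9 (K := 100)
    (n := P.respLen) (hfr (q - m / 2) le_rfl).resp (by decide)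
  refine ⟨f (q - m / 2), (h1.seq_det (h2.seq_det h3)).mono ?_⟩
  have e1 := pow_le_bits (P := P) (q := q) (show 2 ≤ 4 by norm_num)
  have e2 := pow_le_bits (P := P) (q := q) (show 3 ≤ 4 by norm_num)
  have e3 : bits P q ≤ bits P q ^ 4 := by
    simpa using pow_le_bits (P := P) (q := q) (show 1 ≤ 4 by norm_num)
  have e4 : (q - m / 2) * (4000 * bits P q ^ 3 + 100 * bits P q ^ 2 + 1) ≤
      bits P q * (4000 * bits P q ^ 3 + 100 * bits P q ^ 2 + 1) :=
    Nat.mul_le_mul_right _ (by omega)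
  have e5 : bits P q * (4000 * bits P q ^ 3 + 100 * bits P q ^ 2 + 1) =
    4000 * bits P q ^ 4 + 100 * bits P q ^ 3 + bits P q := by ring
  omega

/-- The store at the end of the first stage, with seed `s`, choice `m`, and outcomes `x` and `a`. -/
def firstStore (P : SigmaProtocol) (q s m x a : ℕ) : Store :=
  Function.update (Function.update (Function.update (Function.update (Function.update
    (Function.update (Function.update (Function.update (TwoStage.initStore P q) 20 (2 ^ P.comLen))
      21 (2 ^ lowLen P q)) 22 (2 ^ highLen P)) 23 s) 24 m) 25 (m / 2)) 6 x) 7 a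

/-- The amplitude of a sequence of coin tosses in the first stage. -/
def tossAmp (P : SigmaProtocol) (q : ℕ) : ℂ :=
  (((1 / Real.sqrt 2) ^ (2 * q + 1) : ℝ) : ℂ) * (((1 / Real.sqrt 2) ^ seedLen P q : ℝ) : ℂ)

theorem bounded_initStore : Store.Bounded (bits P q) (TwoStage.initStore P q) := by
  have hsz := sizeParam_lt_bits (P := P) (q := q)
  unfold sizeParam at hsz
  intro v
  unfold TwoStage.initStore
  split_ifs
  · exact lt_two_pow_bits (by omega)
  · exact lt_two_pow_bits (by omega)
  · exact lt_two_pow_bits (by omega)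
  · exact lt_two_pow_bits (by omega)
  · exact P.chalCard_le.trans_lt (two_pow_lt_two_pow_bits (by omega))
  · exact lt_two_pow_bits (by omega)
  · positivity

theorem spec_firstProg (hw : w < bits P q) (A : FSAdversary P q E) :
    firstProg.Spec A (TwoStage.initStore P q) (embed w A.init)
      ((List.range (2 ^ seedLen P q)).flatMap fun s =>
        (List.range (2 ^ (2 * q + 1))).flatMap fun v =>
          (List.range (2 ^ P.instLen)).flatMap fun x =>
            (List.range (2 ^ P.comLen)).map fun a =>
              (firstStore P q s (v % (2 * q + 1)) x a,
                embed w (projX (BitVec.ofNat _ x, BitVec.ofNat _ a) (tossAmp P q •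
                  A.stateAfter (hashOracle P q s) (v % (2 * q + 1) / 2)))))
      (11000 * bits P q ^ 4) := by
  have hB := one_le_bits (P := P) (q := q)
  have hsz := sizeParam_lt_bits (P := P) (q := q)
  have hlow := lowLen_add_lt_bits (P := P) (q := q)
  have hseed := seedLen_lt_bits (P := P) (q := q)
  have hhigh : 1 ≤ highLen P := Nat.le_add_left _ _
  unfold sizeParam at hsz
  have b0 := bounded_initStore (P := P) (q := q)
  have p1 := Code.runs_pow2 hB b0 20 (.var 1) (K := 100) (n := P.comLen)
    (by simp [Expr.eval, TwoStage.initStore]) (by omega) (by decide)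
  have b1 := b0.update (v := 20) (two_pow_lt_two_pow_bits (show P.comLen < bits P q by omega))
  have p2 := Code.runs_pow2 hB b1 21 lowLenExpr (K := 100) (n := lowLen P q)
    (by simp [Expr.eval, lowLenExpr, TwoStage.initStore, lowLen]) (by omega) (by decide)
  have b2 := b1.update (v := 21) (two_pow_lt_two_pow_bits (show lowLen P q < bits P q by omega))
  have p3 := Code.runs_pow2 hB b2 22 highLenExpr (K := 100) (n := highLen P)
    (by simp [Expr.eval, highLenExpr, TwoStage.initStore, highLen]) (by omega) (by decide)
  have b3 := b2.update (v := 22) (two_pow_lt_two_pow_bits (show highLen P < bits P q by omega))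
  have h1 := Prog.spec_classical (A := A) (ψ := embed w A.init) (p1.seq (p2.seq p3))
  set σ₀ : Store := Function.update (Function.update (Function.update (TwoStage.initStore P q)
    20 (2 ^ P.comLen)) 21 (2 ^ lowLen P q)) 22 (2 ^ highLen P) with hσ₀
  have hready : ∀ s < 2 ^ seedLen P q, Ready P q s (Function.update σ₀ 23 s) := by
    intro s hs
    constructor <;> first
      | exact b3.update (hs.trans (two_pow_lt_two_pow_bits hseed))
      | simp [hσ₀, TwoStage.initStore]
  have h2 := Prog.spec_toss (A := A) (ψ := embed w A.init) hB b3
    (.mul (.add lowLenExpr highLenExpr) (.mul (.lit 2) (.var 5))) 23 (K := 1000)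
    (n := seedLen P q)
    (by simp [Expr.eval, lowLenExpr, highLenExpr, TwoStage.initStore, highLen, seedLen, lowLen, hσ₀])
    (by decide)
  refine Prog.Spec.mono (h1.seq_det (h2.seq (τ₂ := 7500 * bits P q ^ 4) ?_)) ?_
  swap
  · have e1 := pow_le_bits (P := P) (q := q) (show 2 ≤ 4 by norm_num)
    have e2 := pow_le_bits (P := P) (q := q) (show 3 ≤ 4 by norm_num)
    have e3 : bits P q ≤ bits P q ^ 4 := by
      simpa using pow_le_bits (P := P) (q := q) (show 1 ≤ 4 by norm_num)
    have e4 : ∀ n < bits P q, (n + 2) * (2 * 100 * bits P q ^ 2) ≤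
        200 * bits P q ^ 3 + 400 * bits P q ^ 2 := by
      intro n hn
      calc (n + 2) * (2 * 100 * bits P q ^ 2) ≤ (bits P q + 2) * (2 * 100 * bits P q ^ 2) :=
            Nat.mul_le_mul_right _ (by omega)
        _ = _ := by ring
    have e5 := e4 P.comLen (by omega)
    have e6 := e4 (lowLen P q) (by omega)
    have e7 := e4 (highLen P) (by omega)
    omega
  intro s hs
  have r0 := hready s (List.mem_range.1 hs)
  have h3 := Prog.spec_toss (A := A)
    (ψ := fun b => (((1 / Real.sqrt 2) ^ seedLen P q : ℝ) : ℂ) • embed w A.init b) hB r0.bounded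
    (.add (.mul (.lit 2) (.var 5)) (.lit 1)) 24 (K := 100)
    (n := 2 * q + 1) (congrArg (2 * · + 1) r0.queries) (by decide)
  refine Prog.Spec.mono (h3.seq (τ₂ := 7000 * bits P q ^ 4) ?_) ?_
  swap
  · have e1 := pow_le_bits (P := P) (q := q) (show 2 ≤ 4 by norm_num)
    have e3 : bits P q ≤ bits P q ^ 4 := by
      simpa using pow_le_bits (P := P) (q := q) (show 1 ≤ 4 by norm_num)
    omega
  intro v hv
  have hv' := List.mem_range.1 hv
  set m := v % (2 * q + 1) with hm
  have hm2 : m < 2 * q + 1 := Nat.mod_lt _ (by omega)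
  have hinit : (fun b => (((1 / Real.sqrt 2) ^ (2 * q + 1) : ℝ) : ℂ) •
      (((1 / Real.sqrt 2) ^ seedLen P q : ℝ) : ℂ) • embed w A.init b) =
      embed w (tossAmp P q • A.init) := by
    rw [embed_smul, tossAmp]
    funext b
    rw [smul_smul]
  rw [hinit]
  have r1 : Ready P q s (Function.update (Function.update σ₀ 23 s) 24 v) :=
    r0.update (by decide) (hv'.trans (two_pow_lt_two_pow_bits (by omega)))
  have h4 := Prog.spec_classical (A := A) (ψ := embed w (tossAmp P q • A.init))
    (Code.runs_assign hB r1.bounded 24 (.mod (.var 24) (.add (.mul (.lit 2) (.var 5)) (.lit 1)))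
      (K := 100) (n := m) (by simp [Expr.eval, hm, hσ₀, TwoStage.initStore]) (by decide))
  rw [Function.update_idem] at h4
  -- Variable `25` is still `0`, and so it need not be set before the loop.
  let f : ℕ → Store := fun i =>
    Function.update (Function.update (Function.update σ₀ 23 s) 24 m) 25 i
  have r2 : ∀ i ≤ q, Ready P q s (f i) := fun i hi =>
    (r0.update (by decide) (lt_two_pow_bits (by omega))).update (by decide)
      (lt_two_pow_bits (by omega))
  have hf0 : Function.update (Function.update σ₀ 23 s) 24 m = f 0 := by
    refine (Function.update_eq_self_iff.2 ?_).symm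
    simp [hσ₀, TwoStage.initStore]
  rw [hf0] at h4
  have h5 := Prog.spec_loop (A := A) hB (.div (.var 24) (.lit 2)) stepProg (K := 100) (n := m / 2)
    (τ := 4000 * bits P q ^ 3) f
    (fun i => embed w (tossAmp P q • A.stateAfter (hashOracle P q s) i)) (r2 0 (by omega)).bounded
    (by simp [Expr.eval, f]) (by decide) (by
      intro i hi
      have f25 : f i 25 = i := by simp [f]
      have f26 : f i 26 = 0 := by simp [f, hσ₀, TwoStage.initStore]
      have g1 := (r2 i (by omega)).spec_stepProg hw (c := ⟨0, P.chalCard_pos⟩)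
        (fun h0 => absurd f26 h0) A (tossAmp P q • A.stateAfter (hashOracle P q s) i)
      have hO : storeOracle P q s (f i) ⟨0, P.chalCard_pos⟩ = hashOracle P q s := if_pos f26
      rw [hO, f25, map_smul, A.step_apply] at g1
      convert g1 using 3
      · simp [f]
      · rfl)
  have r3 := r2 (m / 2) (by omega)
  have h6 := Prog.spec_measure (A := A)
    (ψ := embed w (tossAmp P q • A.stateAfter (hashOracle P q s) (m / 2))) hB r3.bounded
    Reg.inst (.var 0) 6 (K := 100) (n := P.instLen) r3.inst (by decide)
  refine Prog.Spec.mono (h4.seq_det (h5.seq_det (h6.seq (τ₂ := 200 * bits P q ^ 4) ?_))) ?_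
  swap
  · have e1 := pow_le_bits (P := P) (q := q) (show 2 ≤ 4 by norm_num)
    have e3 : bits P q ≤ bits P q ^ 4 := by
      simpa using pow_le_bits (P := P) (q := q) (show 1 ≤ 4 by norm_num)
    have e4 : m / 2 * (4000 * bits P q ^ 3 + 1) ≤ bits P q * (4000 * bits P q ^ 3 + 1) :=
      Nat.mul_le_mul_right _ (by omega)
    have e5 : bits P q * (4000 * bits P q ^ 3 + 1) = 4000 * bits P q ^ 4 + bits P q := by ring
    omega
  intro x hx
  have hx' := List.mem_range.1 hx
  have r4 := r3.update (v := 6) (n := x) (by decide)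
    (hx'.trans (two_pow_lt_two_pow_bits (by omega)))
  have h7 := Prog.spec_measure (A := A)
    (ψ := measOp Reg.inst 0 P.instLen x
      (embed w (tossAmp P q • A.stateAfter (hashOracle P q s) (m / 2)))) hB r4.bounded
    Reg.com (.var 1) 7 (K := 100) (n := P.comLen) r4.com (by decide)
  have h8 : (List.range (2 ^ P.comLen)).map (fun a => (firstStore P q s m x a,
      embed w (projX (BitVec.ofNat _ x, BitVec.ofNat _ a) (tossAmp P q •
        A.stateAfter (hashOracle P q s) (m / 2))))) =
      (List.range (2 ^ P.comLen)).map (fun a => (Function.update (Function.update (f (m / 2)) 6 x) 7 a,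
        measOp Reg.com 0 P.comLen a (measOp Reg.inst 0 P.instLen x
          (embed w (tossAmp P q • A.stateAfter (hashOracle P q s) (m / 2)))))) := by
    refine List.map_congr_left fun a ha => ?_
    rw [measOp_measOp_embed hx' (List.mem_range.1 ha)]
    rfl
  rw [h8]
  refine h7.mono ?_
  have e1 := pow_le_bits (P := P) (q := q) (show 2 ≤ 4 by norm_num)
  have e3 : bits P q ≤ bits P q ^ 4 := by
    simpa using pow_le_bits (P := P) (q := q) (show 1 ≤ 4 by norm_num)
  omega

end programs

/-! ### Running time and success probability of the reduction -/

section analysis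

variable {P : SigmaProtocol} {q w : ℕ} {E : Type*} [NormedAddCommGroup E] [InnerProductSpace ℂ E]

theorem firstStore_ready {s m x a c : ℕ} (hs : s < 2 ^ seedLen P q) (hm : m ≤ 2 * q)
    (hx : x < 2 ^ P.instLen) (ha : a < 2 ^ P.comLen) (hc : c < P.chalCard) :
    Ready P q s (Function.update (firstStore P q s m x a) 8 c) := by
  have hsz := sizeParam_lt_bits (P := P) (q := q)
  have hlow := lowLen_add_lt_bits (P := P) (q := q)
  have hseed := seedLen_lt_bits (P := P) (q := q)
  unfold sizeParam at hsz
  have hb : Store.Bounded (bits P q) (Function.update (firstStore P q s m x a) 8 c) :=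
    ((((((((bounded_initStore.update (two_pow_lt_two_pow_bits (by omega))).update
      (two_pow_lt_two_pow_bits (by omega))).update (two_pow_lt_two_pow_bits (by omega))).update
      (hs.trans (two_pow_lt_two_pow_bits hseed))).update (lt_two_pow_bits (by omega))).update
      (lt_two_pow_bits (by omega))).update (hx.trans (two_pow_lt_two_pow_bits (by omega)))).update
      (ha.trans (two_pow_lt_two_pow_bits (by omega)))).update
      ((hc.trans_le P.chalCard_le).trans (two_pow_lt_two_pow_bits (by omega)))
  constructor <;> first
    | exact hb
    | simp [firstStore, TwoStage.initStore]

theorem spec_secondProg_firstStore (hw : w < bits P q) {s m x a : ℕ} (hs : s < 2 ^ seedLen P q)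
    (hm : m ≤ 2 * q) (hx : x < 2 ^ P.instLen) (ha : a < 2 ^ P.comLen) (c : P.Chal)
    (A : FSAdversary P q E) (r : ℂ) :
    ∃ σ', secondProg.Spec A (Function.update (firstStore P q s m x a) 8 c.val)
      (embed w (projX (BitVec.ofNat _ x, BitVec.ofNat _ a)
        (r • A.stateAfter (hashOracle P q s) (m / 2))))
      ((List.range (2 ^ P.respLen)).map fun z => (Function.update σ' 9 z,
        measOp Reg.resp 0 P.respLen z (embed w (r • A.measured (hashOracle P q s)
          (Function.update (hashOracle P q s) (BitVec.ofNat _ x, BitVec.ofNat _ a) c)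
          (BitVec.ofNat _ x, BitVec.ofNat _ a) m)))) (5000 * bits P q ^ 4) := by
  have h6 : Function.update (firstStore P q s m x a) 8 c.val 6 = x := by simp [firstStore]
  have h7 : Function.update (firstStore P q s m x a) 8 c.val 7 = a := by simp [firstStore]
  have h8 : Function.update (firstStore P q s m x a) 8 c.val 8 = c.val := by simp
  have h24 : Function.update (firstStore P q s m x a) 8 c.val 24 = m := by simp [firstStore]
  have h25 : Function.update (firstStore P q s m x a) 8 c.val 25 = m / 2 := by simp [firstStore]
  have h := (firstStore_ready hs hm hx ha c.isLt).spec_secondProg hw (c := c)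
    (by rw [h6]; exact hx) (by rw [h7]; exact ha) h8 (by rw [h24]; exact hm)
    (by rw [h25, h24]) A (projX (BitVec.ofNat _ x, BitVec.ofNat _ a)
      (r • A.stateAfter (hashOracle P q s) (m / 2)))
  rw [h6, h7, h24, map_smul, map_smul] at h
  rw [map_smul]
  exact h

theorem workLen_reduction : reduction.workLen P q = 0 := by
  simp [TwoStage.workLen, reduction]

theorem isPolyTime_reduction : TwoStage.IsPolyTime.{u} reduction := by
  refine ⟨Polynomial.C 16000 * (Polynomial.C 8 * (Polynomial.X + 1) ^ 3) ^ 4, ?_⟩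
  intro P q E _ _ A c g hg g' hg'
  have hw : reduction.workLen P q < bits P q := by
    rw [workLen_reduction]; exact one_le_bits
  obtain ⟨h1, h2⟩ := spec_firstProg hw A 0
  have h3 := h2 g hg
  have h4 := List.mem_map_of_mem (f := Config.erase) hg
  rw [show TwoStage.runFirst reduction A = firstProg.exec A ⟨TwoStage.initStore P q,
    embed (reduction.workLen P q) A.init, 0⟩ from rfl, h1] at h4
  simp only [List.mem_flatMap, List.mem_map, List.mem_range] at h4
  obtain ⟨s, hs, v, hv, x, hx, a, ha, h5⟩ := h4
  obtain ⟨σ', h6⟩ := spec_secondProg_firstStore hw hs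
    (Nat.le_of_lt_succ (Nat.mod_lt v (by omega : 0 < 2 * q + 1))) hx ha c A (tossAmp P q)
  simp only [Config.erase, Prod.mk.injEq] at h5
  rw [h5.1, h5.2] at h6
  have h7 := (h6 g.time).2 g' hg'
  simp only [Polynomial.eval_mul, Polynomial.eval_C, Polynomial.eval_pow, Polynomial.eval_add,
    Polynomial.eval_X, Polynomial.eval_one]
  have h8 : (8 * (sizeParam P q + 1) ^ 3) = bits P q := rfl
  rw [h8]
  omega

theorem Prog.Spec.sum_map {A : FSAdversary P q E} {p : Prog} {σ : Store} {ψ : Mem P w → E}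
    {l : List (Store × (Mem P w → E))} {τ : ℕ} (h : p.Spec A σ ψ l τ) (t : ℕ)
    (F : Store × (Mem P w → E) → ℝ) :
    ((p.exec A ⟨σ, ψ, t⟩).map fun g => F g.erase).sum = (l.map F).sum := by
  rw [← (h t).1, List.map_map]
  rfl

theorem sum_map_range {f : ℕ → ℝ} (n : ℕ) :
    ((List.range n).map f).sum = ∑ i ∈ Finset.range n, f i := by
  induction n with
  | zero => simp
  | succ n ih => rw [List.sum_range_succ, Finset.sum_range_succ, ih]

theorem sum_map_flatMap_range {α : Type*} (n : ℕ) (f : ℕ → List α) (F : α → ℝ) :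
    (((List.range n).flatMap f).map F).sum = ∑ i ∈ Finset.range n, ((f i).map F).sum := by
  rw [← sum_map_range, List.map_flatMap, List.flatMap_def, List.sum_flatten, List.map_map]
  rfl

theorem sum_range_ofNat (n : ℕ) (f : BitVec n → ℝ) :
    ∑ i ∈ Finset.range (2 ^ n), f (BitVec.ofNat n i) = ∑ y : BitVec n, f y := by
  rw [← Fin.sum_univ_eq_sum_range (fun i => f (BitVec.ofNat n i)),
    ← Equiv.sum_comp (BitVec.equivFin (m := n)).symm.toEquiv f]
  refine Finset.sum_congr rfl fun i _ => congrArg f ?_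
  refine BitVec.eq_of_toNat_eq ?_
  rw [BitVec.toNat_ofNat, Nat.mod_eq_of_lt i.isLt]
  rfl

/-- A sufficiently long random number, reduced modulo `C`, takes every value with at least half of
the uniform probability. -/
theorem sum_mod_ge {C Y : ℕ} (hC : 0 < C) (h : 2 * C ≤ Y) (f : ℕ → ℝ) (hf : ∀ i, 0 ≤ f i) :
    (1 / (2 * C) : ℝ) * ∑ i ∈ Finset.range C, f i ≤ (∑ v ∈ Finset.range Y, f (v % C)) / Y := by
  have h1 := half_average_le_average_mod (X := Unit) (Y := Y) hC (by omega) (by simpa using h)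
    (fun H => f (H ()).val) (fun H => hf _)
  have h2 : ∀ (n : ℕ) (g : ℕ → ℝ), ∑ H : Unit → Fin n, g (H ()).val = ∑ i ∈ Finset.range n, g i := by
    intro n g
    rw [← Fin.sum_univ_eq_sum_range, ← Equiv.sum_comp (Equiv.funUnique Unit (Fin n))]
    rfl
  have h3 : ∑ G : Unit → Fin Y, f ((G ()).val % C) = _ := h2 Y fun v => f (v % C)
  simp only [h2 C f, h3] at h1
  simp only [Fintype.card_fun, Fintype.card_fin, Fintype.card_unit, pow_one] at h1
  refine le_trans (le_of_eq ?_) h1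
  field_simp

theorem norm_tossAmp_sq :
    ‖tossAmp P q‖ ^ 2 = 1 / ((2 : ℝ) ^ (2 * q + 1) * 2 ^ seedLen P q) := by
  have h1 : ∀ n : ℕ, ‖(((1 / Real.sqrt 2) ^ n : ℝ) : ℂ)‖ ^ 2 = 1 / (2 : ℝ) ^ n := by
    intro n
    rw [Complex.norm_real, Real.norm_eq_abs, sq_abs, ← pow_mul, mul_comm, pow_mul, div_pow,
      Real.sq_sqrt (by norm_num), one_pow, one_div_pow]
  rw [tossAmp, norm_mul, mul_pow, h1, h1, one_div_mul_one_div]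

/-- A lower bound for the weight of the accepting branches of the second stage, started in a branch of
the first one: those in which the final content of the register `X` differs from the message sent are
neglected. -/
theorem secondStage_weight_ge (hw : w < bits P q) {s m x a : ℕ} (hs : s < 2 ^ seedLen P q)
    (hm : m ≤ 2 * q) (hx : x < 2 ^ P.instLen) (ha : a < 2 ^ P.comLen) (c : P.Chal)
    (A : FSAdversary P q E) (x₀ : BitVec P.instLen) (g : Config P w E)
    (hg : g.erase = (firstStore P q s m x a, embed w (projX (BitVec.ofNat _ x, BitVec.ofNat _ a)
        (tossAmp P q • A.stateAfter (hashOracle P q s) (m / 2))))) :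
    (if BitVec.ofNat P.instLen x = x₀ then ‖tossAmp P q‖ ^ 2 *
      A.measuredWeight (hashOracle P q s) (x₀, BitVec.ofNat _ a) c m else 0) ≤
    ((secondProg.exec A { g with store := Function.update g.store 8 c.val }).map fun g' =>
      if TwoStage.outInst g = x₀ ∧ P.V (TwoStage.outInst g) (TwoStage.outCom g) c
        (TwoStage.outResp g') = true then g'.weight else 0).sum := by
  obtain ⟨σ', h⟩ := spec_secondProg_firstStore hw hs hm hx ha c A (tossAmp P q)
  simp only [Config.erase, Prod.mk.injEq] at hg
  rw [← hg.1, ← hg.2] at h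
  have hI : (TwoStage.outInst g : BitVec P.instLen) = BitVec.ofNat _ x := by
    unfold TwoStage.outInst
    rw [hg.1]
    simp [firstStore]
  have hA : (TwoStage.outCom g : BitVec P.comLen) = BitVec.ofNat _ a := by
    unfold TwoStage.outCom
    rw [hg.1]
    simp [firstStore]
  rw [hI, hA]
  have h1 := h.sum_map g.time fun y => if BitVec.ofNat P.instLen x = x₀ ∧
    P.V (BitVec.ofNat P.instLen x) (BitVec.ofNat _ a) c (BitVec.ofNat _ (y.1 9)) = true then
      ∑ b : Mem P w, ‖y.2 b‖ ^ 2 else 0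
  refine le_trans ?_ h1.ge
  rw [List.map_map, sum_map_range]
  simp only [Function.comp_apply, Function.update_self]
  split
  · rename_i hx0
    subst hx0
    simp only [true_and]
    rw [sum_measOp_resp_embed _ (fun z =>
      P.V (BitVec.ofNat P.instLen x) (BitVec.ofNat _ a) c z = true)]
    rw [FSAdversary.measuredWeight, Finset.mul_sum]
    refine Finset.sum_le_sum fun b _ => ?_
    by_cases hV : P.V (BitVec.ofNat P.instLen x) (BitVec.ofNat _ a) c b.2.2.2 = true
    · simp only [hV, and_true, if_true]
      rw [PiLp.smul_apply, norm_smul, mul_pow]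
      split
      · exact le_rfl
      · rw [mul_zero]; positivity
    · simp [hV]
  · rename_i hx0
    simp [hx0]

theorem sum_le_sum_of_map_eq {α β : Type*} (xs : List α) (l : List β) (e : α → β) (F : α → ℝ)
    (G : β → ℝ) (h : xs.map e = l) (hFG : ∀ x ∈ xs, G (e x) ≤ F x) :
    (l.map G).sum ≤ (xs.map F).sum := by
  subst h
  rw [List.map_map]
  exact List.sum_le_sum hFG

/-- The factor `36 * q ^ 2` is at least `(2 * (2 * q + 1)) ^ 2`: both the seed and the choice of `m`
lose a factor of `2` over `(2 * q + 1) ^ 2`. -/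
theorem forgeProb_le_acceptProb (A : FSAdversary P q E) (hq : 1 ≤ q) (x₀ : BitVec P.instLen) :
    1 / (36 * (q : ℝ) ^ 2) * A.forgeProb x₀ ≤ reduction.acceptProb A x₀ := by
  have hw : reduction.workLen P q < bits P q := by
    rw [workLen_reduction]; exact one_le_bits
  have hC : (0 : ℝ) < P.chalCard := by exact_mod_cast P.chalCard_pos
  have hq' : (1 : ℝ) ≤ q := by exact_mod_cast hq
  -- The lower bound for a branch can be read off from its store.
  let G : P.Chal → Store × (Mem P (reduction.workLen P q) → E) → ℝ := fun c y =>
    if BitVec.ofNat P.instLen (y.1 6) = x₀ then ‖tossAmp P q‖ ^ 2 *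
      A.measuredWeight (hashOracle P q (y.1 23)) (x₀, BitVec.ofNat _ (y.1 7)) c (y.1 24) else 0
  obtain ⟨h1, -⟩ := spec_firstProg hw A 0
  let W : P.Chal → BitVec P.comLen → ℕ → ℕ → ℝ := fun c a m s =>
    A.measuredWeight (hashOracle P q s) (x₀, a) c m
  have hW : ∀ c a m s, 0 ≤ W c a m s := fun c a m s => A.measuredWeight_nonneg _ _ _ _
  have h2 : ∀ c : P.Chal, ‖tossAmp P q‖ ^ 2 * ∑ s ∈ Finset.range (2 ^ seedLen P q),
      ∑ v ∈ Finset.range (2 ^ (2 * q + 1)), ∑ a, W c a (v % (2 * q + 1)) s ≤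
      ((reduction.runFirst A).map fun g => ((reduction.runSecond A g c).map fun g' =>
        if TwoStage.outInst g = x₀ ∧ P.V (TwoStage.outInst g) (TwoStage.outCom g) c
          (TwoStage.outResp g') = true then g'.weight else 0).sum).sum := by
    intro c
    refine le_trans ?_ (sum_le_sum_of_map_eq _ _ Config.erase _ (G c) h1 ?_)
    · simp only [sum_map_flatMap_range, List.map_map, sum_map_range, Function.comp_apply, G]
      refine le_of_eq ?_
      rw [Finset.mul_sum]
      refine Finset.sum_congr rfl fun s _ => ?_
      rw [Finset.mul_sum]
      refine Finset.sum_congr rfl fun v _ => ?_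
      have e6 : ∀ m x a, firstStore P q s m x a 6 = x := fun m x a => by simp [firstStore]
      have e7 : ∀ m x a, firstStore P q s m x a 7 = a := fun m x a => by simp [firstStore]
      have e23 : ∀ m x a, firstStore P q s m x a 23 = s := fun m x a => by simp [firstStore]
      have e24 : ∀ m x a, firstStore P q s m x a 24 = m := fun m x a => by simp [firstStore]
      simp only [e6, e7, e23, e24]
      rw [sum_range_ofNat P.instLen fun y => ∑ a ∈ Finset.range (2 ^ P.comLen),
        if y = x₀ then ‖tossAmp P q‖ ^ 2 * A.measuredWeight (hashOracle P q s)
          (x₀, BitVec.ofNat _ a) c (v % (2 * q + 1)) else 0, Finset.sum_eq_single x₀]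
      · simp only [if_true]
        rw [sum_range_ofNat P.comLen fun y => ‖tossAmp P q‖ ^ 2 *
          A.measuredWeight (hashOracle P q s) (x₀, y) c (v % (2 * q + 1)), Finset.mul_sum]
      · intro y _ hy
        simp [hy]
      · simp
    · intro g hg
      have h4 := List.mem_map_of_mem (f := Config.erase) hg
      rw [show firstProg.exec A ⟨TwoStage.initStore P q,
        embed (reduction.workLen P q) A.init, 0⟩ = TwoStage.runFirst reduction A from rfl] at h1
      rw [h1] at h4
      simp only [List.mem_flatMap, List.mem_map, List.mem_range] at h4
      obtain ⟨s, hs, v, hv, x, hx, a, ha, h5⟩ := h4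
      have h6 := secondStage_weight_ge hw hs
        (Nat.le_of_lt_succ (Nat.mod_lt v (by omega : 0 < 2 * q + 1))) hx ha c A x₀ g h5.symm
      rw [← h5]
      simp only [G]
      have e6 : ∀ m, firstStore P q s m x a 6 = x := fun m => by simp [firstStore]
      have e7 : ∀ m, firstStore P q s m x a 7 = a := fun m => by simp [firstStore]
      have e23 : ∀ m, firstStore P q s m x a 23 = s := fun m => by simp [firstStore]
      have e24 : ∀ m, firstStore P q s m x a 24 = m := fun m => by simp [firstStore]
      rw [e6, e7, e23, e24]
      exact h6
  have hpow : 2 * (2 * q + 1) ≤ 2 ^ (2 * q + 1) := by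
    rw [pow_succ, mul_comm]
    exact Nat.mul_le_mul_right _ Nat.lt_two_pow_self
  -- The choice of `m` is uniform up to a factor of at most `2`.
  have h3 : ∀ c : P.Chal, 1 / (2 * (2 * q + 1) : ℝ) * ∑ a, ∑ m ∈ Finset.range (2 * q + 1),
      (∑ s ∈ Finset.range (2 ^ seedLen P q), W c a m s) / 2 ^ seedLen P q ≤
      ‖tossAmp P q‖ ^ 2 * ∑ s ∈ Finset.range (2 ^ seedLen P q),
        ∑ v ∈ Finset.range (2 ^ (2 * q + 1)), ∑ a, W c a (v % (2 * q + 1)) s := by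
    intro c
    have h := sum_mod_ge (by omega : 0 < 2 * q + 1) hpow
      (fun m => ∑ s ∈ Finset.range (2 ^ seedLen P q), ∑ a, W c a m s)
      (fun m => Finset.sum_nonneg fun s _ => Finset.sum_nonneg fun a _ => hW c a m s)
    have h' := div_le_div_of_nonneg_right h (by positivity : (0 : ℝ) ≤ 2 ^ seedLen P q)
    refine (le_of_eq ?_).trans (h'.trans_eq ?_)
    · have : ∑ a, ∑ m ∈ Finset.range (2 * q + 1),
          (∑ s ∈ Finset.range (2 ^ seedLen P q), W c a m s) / 2 ^ seedLen P q =
          (∑ m ∈ Finset.range (2 * q + 1), ∑ s ∈ Finset.range (2 ^ seedLen P q), ∑ a, W c a m s) /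
            2 ^ seedLen P q := by
        rw [Finset.sum_comm, Finset.sum_div]
        refine Finset.sum_congr rfl fun m _ => ?_
        rw [← Finset.sum_div, Finset.sum_comm]
      rw [this]
      push_cast
      ring
    · rw [norm_tossAmp_sq, Finset.sum_comm]
      push_cast
      field_simp
  have h4 := A.forgeProb_le_hashOracle hq x₀
  set R : ℝ := (∑ c : P.Chal, ∑ a, ∑ m ∈ Finset.range (2 * q + 1),
      (∑ s ∈ Finset.range (2 ^ seedLen P q), A.measuredWeight (hashOracle P q s) (x₀, a) c m) /
        2 ^ seedLen P q) / (P.chalCard : ℝ) with hR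
  have hR0 : 0 ≤ R := div_nonneg (Finset.sum_nonneg fun c _ => Finset.sum_nonneg fun a _ =>
    Finset.sum_nonneg fun m _ => div_nonneg (Finset.sum_nonneg fun s _ => hW c a m s)
      (by positivity)) hC.le
  have h5 : 1 / (2 * (2 * q + 1) : ℝ) * R ≤ reduction.acceptProb A x₀ := by
    rw [hR, ← mul_div_assoc, Finset.mul_sum]
    exact div_le_div_of_nonneg_right
      (Finset.sum_le_sum fun c _ => (h3 c).trans (h2 c)) hC.le
  refine le_trans ?_ h5
  calc 1 / (36 * (q : ℝ) ^ 2) * A.forgeProb x₀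
      ≤ 1 / (36 * (q : ℝ) ^ 2) * (2 * (2 * q + 1) * R) := by gcongr
    _ = (2 * (2 * q + 1)) / (36 * (q : ℝ) ^ 2) * R := by ring
    _ ≤ _ := by
      refine mul_le_mul_of_nonneg_right ?_ hR0
      rw [div_le_div_iff₀ (by positivity) (by positivity)]
      nlinarith

end analysis

end

end FiatShamir

theorem theorem2 :
    ∃ S : FiatShamir.TwoStage, FiatShamir.TwoStage.IsPolyTime.{u} S ∧
      ∃ K : ℝ, 0 < K ∧
        ∀ (P : FiatShamir.SigmaProtocol) (q : ℕ), 1 ≤ q →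
        ∀ (E : Type u) [NormedAddCommGroup E] [InnerProductSpace ℂ E]
          (A : FiatShamir.FSAdversary P q E),
          ∃ ε : BitVec P.instLen → ℝ,
            (∀ x₀, 0 ≤ ε x₀) ∧
            ∑ x₀, ε x₀ ≤ 1 / (2 * (q : ℝ) * (P.chalCard : ℝ)) ∧
            ∀ x₀ : BitVec P.instLen,
              1 / (K * (q : ℝ) ^ 2) * A.forgeProb x₀ - ε x₀ ≤ S.acceptProb A x₀ := by
  refine ⟨FiatShamir.reduction, FiatShamir.isPolyTime_reduction, 36, by norm_num,
    fun P q hq E _ _ A => ⟨fun _ => 0, fun _ => le_rfl, ?_, fun x₀ => ?_⟩⟩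
  · rw [Finset.sum_const_zero]
    positivity
  · rw [sub_zero]
    exact FiatShamir.forgeProb_le_acceptProb A hq x₀
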